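/- **Definitions.** A set $E\subset\overline{\mathbb R}=[-\infty,\infty]$ is *nearly closed* if $E\cup\{l,r\}$ is closed in $\overline{\mathbb R}$, where $l=\inf E$ and $r=\sup E$. Let $E_\partial=E\cup\{\partial\}$ be the one-point compactification of $E$ ($\partial$ is isolated if $E$ is compact). A *Hunt process* $X=(\Omega,\mathscr F_t,\theta_t,X_t,\mathbf P_x)$ on $E_\partial$ is a normal, time-homogeneous strong Markov process with respect to a right-continuous filtration $(\mathscr F_t)$ to which it is adapted, such that $x\mapsto \mathbf P_x(X_t\in B)$ is Borel for every Borel set $B\subset E_\partial$, it has shift operators $\theta_t$, all its paths are right-continuous with left limits in $E_\partial$, $\partial$ is a trap, and it is quasi-left-continuous: for stopping times $\sigma_n\uparrow\sigma$, $X_{\sigma_n}\to X_\sigma$ a.s. on $\{\sigma<\infty\}$. Put $T_y=\inf\{t>0:X_t=y\}$ and $\zeta=\inf\{t>0: X_t=\partial\}$ ($\inf\emptyset=\infty$). A Hunt process $X$ on $E_\partial$ is called *skip-free* if * (SF) for every $x\in E$, $\mathbf P_x$-a.s., $(X_{t-}\wedge X_t,\,X_{t-}\vee X_t)\cap E=\emptyset$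 for all $0<t<\zeta$; * (SR) $\mathbf P_x(T_y<\infty)>0$ for all $x,y\in E$; * (SK) if $\mathbf P_x(\zeta<\infty)>0$ for some $x\in E$, then $l\notin E$ or $r\notin E$, and $\mathbf P_x(X_{\zeta-}\notin E,\ \zeta<\infty)=\mathbf P_x(\zeta<\infty)$. **Theorem.** Let $E\subset\overline{\mathbb R}$ be nearly closed and let $X$ be a skip-free Hunt process on $E_\partial$. Then for all $a,x,b\in E$ with $a<x<b$ the event $\{T_b<T_a\}$ is measurable with respect to the $\mathbf P_x$-completed $\sigma$-algebra, and there exists a continuous and strictly increasing function $\mathbf s:E\to\mathbb R$ such that for all $a,x,b\in E$ with $a<x<b$, $$\mathbf P_x(T_b<T_a)=\frac{\mathbf s(x)-\mathbf s(a)}{\mathbf s(b)-\mathbf s(a)}.$$ If $\tilde{\mathbf s}$ is another function with the same properties, then $\tilde{\mathbf s}=\alpha\mathbf s+\beta$ on $E$ for some $\alpha>0$ and $\beta\in\mathbb R$. -/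

import Mathlib

open Set Filter Topology MeasureTheory
open scoped NNReal ENNReal

noncomputable section

/-- The state space with cemetery carries its Borel `σ`-algebra. -/
instance OnePoint.borelMeasurableSpace (S : Type*) [TopologicalSpace S] :
    MeasurableSpace (OnePoint S) := borel (OnePoint S)

instance OnePoint.borelSpaceInst (S : Type*) [TopologicalSpace S] :
    BorelSpace (OnePoint S) := ⟨rfl⟩

/-- `E ⊆ [-∞, ∞]` is nearly closed if adjoining its two endpoints gives a closed set. -/
def IsNearlyClosed (E : Set EReal) : Prop :=
  IsClosed (E ∪ {sInf E, sSup E})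

/-- A Hunt process on (a locally compact separable metrizable space) `S`, with cemetery
`∂ = OnePoint.infty` (the point at infinity of `S`, isolated when `S` is compact).
The filtration `𝓕` is any right-continuous admissible filtration for which the strong Markov
property and quasi-left-continuity hold, e.g. the minimum augmented admissible one. -/
structure HuntProcess (S : Type*) [TopologicalSpace S] (Ω : Type*) [mΩ : MeasurableSpace Ω] where
  /-- the coordinate process -/
  X : ℝ≥0 → Ω → OnePoint S
  /-- the shift operators -/
  θ : ℝ≥0 → Ω → Ω
  /-- the laws -/
  P : OnePoint S → Measure Ω
  /-- the filtration -/
  𝓕 : Filtration ℝ≥0 mΩ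
  isProbabilityMeasure : ∀ x, IsProbabilityMeasure (P x)
  measurable_law : ∀ (t : ℝ≥0) (B : Set (OnePoint S)), MeasurableSet B →
    Measurable fun x => P x {ω | X t ω ∈ B}
  /-- the process starts at `x` under `P x`, and this holds for the cemetery as well -/
  start : ∀ x, ∀ᵐ ω ∂(P x), X 0 ω = x
  shift : ∀ s t ω, X s (θ t ω) = X (s + t) ω
  /-- the cemetery is a trap -/
  absorbed : ∀ (s t : ℝ≥0) (ω : Ω), s ≤ t → X s ω = OnePoint.infty → X t ω = OnePoint.infty
  rightContinuous_path : ∀ (ω : Ω) (t : ℝ≥0), ContinuousWithinAt (fun s => X s ω) (Ioi t) t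
  exists_leftLimit : ∀ (ω : Ω) (t : ℝ≥0), 0 < t →
    ∃ y : OnePoint S, Tendsto (fun s => X s ω) (𝓝[<] t) (𝓝 y)
  rightContinuous_filtration : 𝓕.IsRightContinuous
  adapted : ∀ t : ℝ≥0, Measurable[𝓕 t] (X t)
  /-- `P_x(X_{τ+t} ∈ B | 𝓕_τ) = P_{X_τ}(X_t ∈ B)` on `{τ < ∞}`, integrated over `A ∈ 𝓕_τ` -/
  strongMarkov : ∀ (τ : Ω → WithTop ℝ≥0) (hτ : IsStoppingTime 𝓕 τ) (x : OnePoint S) (t : ℝ≥0)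
    (B : Set (OnePoint S)), MeasurableSet B →
    ∀ A : Set Ω, MeasurableSet[hτ.measurableSpace] A →
      P x (A ∩ {ω | τ ω < ⊤ ∧ X ((τ ω).untopA + t) ω ∈ B}) =
        ∫⁻ ω in A ∩ {ω | τ ω < ⊤}, P (X (τ ω).untopA ω) {ω' | X t ω' ∈ B} ∂(P x)
  quasiLeftContinuous : ∀ τ : ℕ → Ω → WithTop ℝ≥0, (∀ n, IsStoppingTime 𝓕 (τ n)) →
    (∀ ω, Monotone fun n => τ n ω) → ∀ x : OnePoint S, ∀ᵐ ω ∂(P x), (⨆ n, τ n ω) < ⊤ →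
      Tendsto (fun n => X (τ n ω).untopA ω) atTop (𝓝 (X (⨆ n, τ n ω).untopA ω))

namespace HuntProcess

/-- The hitting time `T_y = inf {t > 0 : X_t = y}`, with `inf ∅ = ∞`. -/
def hit {S : Type*} [TopologicalSpace S] {Ω : Type*} [MeasurableSpace Ω]
    (H : HuntProcess S Ω) (y : OnePoint S) (ω : Ω) : ℝ≥0∞ :=
  ⨅ (t : ℝ≥0) (_ : 0 < t ∧ H.X t ω = y), (t : ℝ≥0∞)

/-- The lifetime `ζ = inf {t > 0 : X_t = ∂}`. -/
def lifetime {S : Type*} [TopologicalSpace S] {Ω : Type*} [MeasurableSpace Ω]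
    (H : HuntProcess S Ω) (ω : Ω) : ℝ≥0∞ :=
  H.hit OnePoint.infty ω

/-- `X_{t-} = y` along the path `ω`. -/
def HasLeftLimit {S : Type*} [TopologicalSpace S] {Ω : Type*} [MeasurableSpace Ω]
    (H : HuntProcess S Ω) (ω : Ω) (t : ℝ≥0) (y : OnePoint S) : Prop :=
  Tendsto (fun s => H.X s ω) (𝓝[<] t) (𝓝 y)

/-- Skip-free Hunt processes on a set `E ⊆ [-∞, ∞]`. -/
structure IsSkipFree {E : Set EReal} {Ω : Type*} [MeasurableSpace Ω]
    (H : HuntProcess E Ω) : Prop where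
  /-- (SF) no point of `E` lies strictly between `X_{t-}` and `X_t`, for `t < ζ` -/
  skipFree : ∀ x : E, ∀ᵐ ω ∂(H.P x), ∀ t : ℝ≥0, 0 < t → (t : ℝ≥0∞) < H.lifetime ω →
    ∀ y z : E, H.HasLeftLimit ω t y → H.X t ω = z → Ioo (min y z) (max y z) = ∅
  /-- (SR) regularity -/
  regular : ∀ x y : E, 0 < H.P x {ω | H.hit y ω < ∞}
  /-- (SK) no killing inside -/
  noKillingInside : ∀ x : E, 0 < H.P x {ω | H.lifetime ω < ∞} →
    (sInf E ∉ E ∨ sSup E ∉ E) ∧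
      ∀ᵐ ω ∂(H.P x), ∀ t : ℝ≥0, H.lifetime ω = t →
        ∃ y : OnePoint E, H.HasLeftLimit ω t y ∧ y ∉ range ((↑) : E → OnePoint E)

/-- `s` is continuous, strictly increasing, and `P_x(T_b < T_a) = (s x - s a) / (s b - s a)` for
all `a < x < b` in `E`. -/
structure IsScaleFunction {E : Set EReal} {Ω : Type*} [MeasurableSpace Ω]
    (H : HuntProcess E Ω) (s : E → ℝ) : Prop where
  continuous : Continuous s
  strictMono : StrictMono s
  prob_hit_lt : ∀ a x b : E, a < x → x < b →
    (H.P x).real {ω | H.hit b ω < H.hit a ω} = (s x - s a) / (s b - s a)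

end HuntProcess

end

/-! ### Topology of the state space and its one-point compactification -/

noncomputable section

/-! Write r(a,x,b) = P_x(T_b < T_a). A skip-free path cannot pass over a point of E without visiting
it. On its way from x to b it therefore visits every y in between, and the strong Markov property at
T_y gives r(a,x,b) = r(a,x,y) r(a,y,b); the same holds with the two directions exchanged
(`prob_T_lt_mul`). Two such identities together with 0 < r < 1 already force the form (s(x) - s(a))
/ (s(b) - s(a)); this is the algebra of `exists_strictMono_of_exitProb`.

Three probabilistic facts complete the argument. Exit in finite time (`ae_T_lt_top`): the path
cannot die inside (a,b), because its left limit at the lifetime is the cemetery while [a,b] is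
compact; and from every point of (a,b) it reaches b within a fixed time with probability bounded
below. So the probabilities of the two exits add up to one. Positivity (`prob_T_lt_pos`): if
r(a,x,b) = 0, a path from a would have to return to a each time it visits x before it could reach b.
These returns are not arbitrarily fast, so b would never be reached, contradicting (SR). Continuity
(`tendsto_prob_T_lt`): if points u_n tending monotonically to x are all hit before a, their hitting
times increase to a time at which the left limit is x, and quasi-left-continuity turns an approached
point into a visited one.

Technically, T_c is replaced by the supremum of the entry times into shrinking open neighbourhoods
of c (`hitTime`). This is a measurable path functional and a stopping time without any completion of
the filtration. By quasi-left-continuity the path is a.s. at c at this time (`ae_attainsHit`), so it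
agrees a.s. with T_c unless the process starts at c. Null measurability of {T_b < T_a} follows. -/

theorem OnePoint.secondCountableTopology_of_locallyCompact (S : Type*) [TopologicalSpace S]
    [T2Space S] [LocallyCompactSpace S] [SecondCountableTopology S] :
    SecondCountableTopology (OnePoint S) := by
  let K : CompactExhaustion S := default
  -- The complements of a compact exhaustion form a countable neighbourhood basis at infinity.
  let 𝓑 : Set (Set (OnePoint S)) :=
    (fun U => ((↑) : S → OnePoint S) '' U) '' TopologicalSpace.countableBasis S ∪
      range fun n => (((↑) : S → OnePoint S) '' K n)ᶜ
  have h𝓑 : 𝓑.Countable :=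
    ((TopologicalSpace.countable_countableBasis S).image _).union (countable_range _)
  refine TopologicalSpace.IsTopologicalBasis.secondCountableTopology (b := 𝓑) ?_ h𝓑
  refine TopologicalSpace.isTopologicalBasis_of_isOpen_of_nhds ?_ ?_
  · rintro _ (⟨U, hU, rfl⟩ | ⟨n, rfl⟩)
    · exact OnePoint.isOpenMap_coe _ (TopologicalSpace.isOpen_of_mem_countableBasis hU)
    · exact OnePoint.isOpen_compl_image_coe.2 ⟨(K.isCompact n).isClosed, K.isCompact n⟩
  · intro a u ha hu
    induction a using OnePoint.rec with
    | infty =>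
      have h := (OnePoint.isOpen_iff_of_mem ha).1 hu
      obtain ⟨n, hn⟩ := K.exists_superset_of_isCompact h.2
      refine ⟨_, Or.inr ⟨n, rfl⟩, by simp, ?_⟩
      intro z hz
      induction z using OnePoint.rec with
      | infty => exact ha
      | coe z =>
        by_contra hzu
        exact hz ⟨z, hn hzu, rfl⟩
    | coe a =>
      obtain ⟨V, hV, haV, hVu⟩ :=
        (TopologicalSpace.isBasis_countableBasis S).exists_subset_of_mem_open
          (show a ∈ ((↑) : S → OnePoint S) ⁻¹' u from ha) (hu.preimage OnePoint.continuous_coe)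
      exact ⟨_, Or.inl ⟨V, hV, rfl⟩, ⟨a, haV, rfl⟩, image_subset_iff.2 hVu⟩

/-- A nearly closed set is a closed set minus at most two points, hence locally closed in a compact
space. -/
theorem IsNearlyClosed.locallyCompactSpace {E : Set EReal} (hE : IsNearlyClosed E) :
    LocallyCompactSpace E := by
  have h : E = (E ∪ {sInf E, sSup E}) ∩ (({sInf E, sSup E} : Set EReal) \ E)ᶜ := by
    ext z; simp only [mem_inter_iff, mem_union, mem_compl_iff, Set.mem_sdiff]; tauto
  have : IsLocallyClosed E := by
    rw [h]
    exact hE.isLocallyClosed.inter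
      ((Set.toFinite _).isClosed.isOpen_compl.isLocallyClosed)
  exact this.locallyCompactSpace

/-- The closed intervals of a nearly closed set are compact. -/
theorem IsNearlyClosed.isCompact_Icc {E : Set EReal} (hE : IsNearlyClosed E) (a b : E) :
    IsCompact (Icc a b) := by
  rw [Subtype.isCompact_iff]
  -- Adjoining the endpoints of E adds nothing between a and b: the infimum can lie there only if it
  -- is a, the supremum only if it is b.
  have : ((↑) : E → EReal) '' Icc a b = Icc (a : EReal) b ∩ (E ∪ {sInf E, sSup E}) := by
    ext z
    constructor
    · rintro ⟨z, hz, rfl⟩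
      exact ⟨hz, Or.inl z.2⟩
    · rintro ⟨⟨h1, h2⟩, h | h | h⟩
      · exact ⟨⟨z, h⟩, ⟨h1, h2⟩, rfl⟩
      · have : z = a := le_antisymm (h ▸ sInf_le a.2) h1
        subst this
        exact ⟨a, ⟨le_rfl, h2⟩, rfl⟩
      · have : z = b := le_antisymm h2 (h ▸ le_sSup b.2)
        subst this
        exact ⟨b, ⟨h1, le_rfl⟩, rfl⟩
  rw [this]
  exact (isClosed_Icc.inter hE).isCompact

/-! ### Entry and hitting times of right-continuous paths -/

section Paths

variable {M : Type*} [TopologicalSpace M]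

/-- Right-continuity of a path. -/
def IsRightContinuousPath (w : ℝ≥0 → M) : Prop := ∀ t, ContinuousWithinAt w (Ioi t) t

/-- The path seen from time `u` on. -/
def shiftPath {M : Type*} (u : ℝ≥0) (w : ℝ≥0 → M) : ℝ≥0 → M := fun t => w (u + t)

theorem IsRightContinuousPath.shift {w : ℝ≥0 → M} (hw : IsRightContinuousPath w) (u : ℝ≥0) :
    IsRightContinuousPath (shiftPath u w) := by
  intro t
  have h : ContinuousWithinAt (fun t : ℝ≥0 => u + t) (Ioi t) t :=
    (continuous_const.add continuous_id).continuousWithinAt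
  refine ContinuousWithinAt.comp (t := Ioi (u + t)) (hw (u + t)) h ?_
  intro s hs
  exact add_lt_add_right hs u

theorem IsRightContinuousPath.exists_gt {w : ℝ≥0 → M} (hw : IsRightContinuousPath w) {t : ℝ≥0}
    {U : Set M} (hU : U ∈ 𝓝 (w t)) : ∃ v, t < v ∧ ∀ s, t ≤ s → s < v → w s ∈ U := by
  have h := hw t hU
  obtain ⟨v, hv, hvU⟩ := (mem_nhdsGT_iff_exists_Ioo_subset).1 h
  refine ⟨v, hv, fun s h1 h2 => ?_⟩
  rcases h1.eq_or_lt with rfl | h1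
  · exact mem_of_mem_nhds hU
  · exact hvU ⟨h1, h2⟩

/-- The first time of a fixed countable dense set of times at which `w` visits `G`; for
right-continuous `w` and open `G` this is the entry time of `G`. -/
def entryTime {M : Type*} (G : Set M) (w : ℝ≥0 → M) : ℝ≥0∞ :=
  ⨅ (n : ℕ) (_ : w (TopologicalSpace.denseSeq ℝ≥0 n) ∈ G),
    (TopologicalSpace.denseSeq ℝ≥0 n : ℝ≥0∞)

theorem exists_denseSeq_between {s t : ℝ≥0} (h : s < t) :
    ∃ n, s < TopologicalSpace.denseSeq ℝ≥0 n ∧ TopologicalSpace.denseSeq ℝ≥0 n < t := by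
  obtain ⟨_, ⟨n, rfl⟩, h⟩ :=
    Dense.exists_between (TopologicalSpace.denseRange_denseSeq ℝ≥0) h
  exact ⟨n, h⟩

theorem entryTime_lt_iff_exists_denseSeq {M : Type*} {G : Set M} {w : ℝ≥0 → M} {t : ℝ≥0∞} :
    entryTime G w < t ↔ ∃ n, w (TopologicalSpace.denseSeq ℝ≥0 n) ∈ G ∧
      (TopologicalSpace.denseSeq ℝ≥0 n : ℝ≥0∞) < t := by
  simp only [entryTime, iInf_lt_iff, exists_prop]

/-- By right-continuity a visit to an open set lasts for some time, and so is seen at a time of the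
dense sequence. -/
theorem entryTime_lt_iff {G : Set M} (hG : IsOpen G) {w : ℝ≥0 → M}
    (hw : IsRightContinuousPath w) {t : ℝ≥0∞} :
    entryTime G w < t ↔ ∃ u : ℝ≥0, w u ∈ G ∧ (u : ℝ≥0∞) < t := by
  rw [entryTime_lt_iff_exists_denseSeq]
  constructor
  · rintro ⟨n, h⟩
    exact ⟨_, h⟩
  · rintro ⟨u, hu, hut⟩
    obtain ⟨v, huv, hv⟩ := hw.exists_gt (hG.mem_nhds hu)
    obtain ⟨t', hut', ht'⟩ := ENNReal.lt_iff_exists_nnreal_btwn.1 hut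
    obtain ⟨n, h1, h2⟩ := exists_denseSeq_between (lt_min huv (ENNReal.coe_lt_coe.1 hut'))
    exact ⟨n, hv _ h1.le (h2.trans_le (min_le_left _ _)),
      lt_trans (ENNReal.coe_lt_coe.2 (h2.trans_le (min_le_right _ _))) ht'⟩

theorem entryTime_le {G : Set M} (hG : IsOpen G) {w : ℝ≥0 → M}
    (hw : IsRightContinuousPath w) {u : ℝ≥0} (hu : w u ∈ G) : entryTime G w ≤ u :=
  le_of_forall_gt fun _ ht => (entryTime_lt_iff hG hw).2 ⟨u, hu, ht⟩

theorem entryTime_anti {M : Type*} {G G' : Set M} (h : G' ⊆ G) (w : ℝ≥0 → M) :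
    entryTime G w ≤ entryTime G' w :=
  le_of_forall_gt fun t ht => by
    rw [entryTime_lt_iff_exists_denseSeq] at ht ⊢
    exact ht.imp fun n hn => ⟨h hn.1, hn.2⟩

theorem mem_closure_of_entryTime_eq {G : Set M} {w : ℝ≥0 → M}
    (hw : IsRightContinuousPath w) {t : ℝ≥0} (ht : entryTime G w = t) : w t ∈ closure G := by
  by_contra hc
  obtain ⟨v, htv, hv⟩ := hw.exists_gt (isClosed_closure.isOpen_compl.mem_nhds hc)
  have : entryTime G w < v := by rw [ht]; exact ENNReal.coe_lt_coe.2 htv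
  obtain ⟨n, hn, hnv⟩ := entryTime_lt_iff_exists_denseSeq.1 this
  refine hv _ ?_ (ENNReal.coe_lt_coe.1 hnv) (subset_closure hn)
  rw [← ENNReal.coe_le_coe, ← ht]
  exact iInf₂_le n hn

theorem entryTime_le_add_shift {G : Set M} (hG : IsOpen G) {w : ℝ≥0 → M}
    (hw : IsRightContinuousPath w) (u : ℝ≥0) :
    entryTime G w ≤ u + entryTime G (shiftPath u w) := by
  refine le_of_forall_gt fun t ht => ?_
  have h : entryTime G (shiftPath u w) < t - u := by
    rw [lt_tsub_iff_left]; exact ht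
  obtain ⟨s, hs, hst⟩ := (entryTime_lt_iff hG (hw.shift u)).1 h
  refine (entryTime_lt_iff hG hw).2 ⟨u + s, hs, ?_⟩
  rw [lt_tsub_iff_left] at hst
  exact_mod_cast hst

theorem measurable_entryTime [MeasurableSpace M] [OpensMeasurableSpace M] {G : Set M}
    (hG : IsOpen G) : Measurable (entryTime G : (ℝ≥0 → M) → ℝ≥0∞) := by
  refine measurable_of_Iio fun t => ?_
  have : entryTime G ⁻¹' Iio t = ⋃ n, {w : ℝ≥0 → M |
      w (TopologicalSpace.denseSeq ℝ≥0 n) ∈ G ∧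
      (TopologicalSpace.denseSeq ℝ≥0 n : ℝ≥0∞) < t} := by
    ext w
    simp only [mem_preimage, mem_Iio, mem_iUnion, mem_ofPred_eq]
    exact entryTime_lt_iff_exists_denseSeq
  rw [this]
  exact MeasurableSet.iUnion fun n =>
    (measurable_pi_apply _ hG.measurableSet).inter (MeasurableSet.const _)

variable [FirstCountableTopology M]

/-- A decreasing sequence of open neighbourhoods of `c` shrinking to `c`. -/
def nbhdSeq (c : M) (n : ℕ) : Set M := interior ((𝓝 c).exists_antitone_basis.choose n)

theorem isOpen_nbhdSeq (c : M) (n : ℕ) : IsOpen (nbhdSeq c n) := isOpen_interior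

theorem mem_nbhdSeq (c : M) (n : ℕ) : c ∈ nbhdSeq c n :=
  mem_interior_iff_mem_nhds.2 ((𝓝 c).exists_antitone_basis.choose_spec.mem n)

theorem nbhdSeq_antitone (c : M) : Antitone (nbhdSeq c) := fun _ _ h =>
  interior_mono ((𝓝 c).exists_antitone_basis.choose_spec.antitone h)

theorem exists_closure_nbhdSeq_subset [T3Space M] {c : M} {U : Set M} (hU : U ∈ 𝓝 c) :
    ∃ n, closure (nbhdSeq c n) ⊆ U := by
  obtain ⟨V, ⟨hV, hVc⟩, hVU⟩ := (closed_nhds_basis c).mem_iff.1 hU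
  obtain ⟨n, hn⟩ := (𝓝 c).exists_antitone_basis.choose_spec.mem_iff.1 hV
  exact ⟨n, (closure_minimal (interior_subset.trans hn) hVc).trans hVU⟩

/-- The limit of the entry times of shrinking neighbourhoods of `c`. -/
def hitTime (c : M) (w : ℝ≥0 → M) : ℝ≥0∞ := ⨆ n, entryTime (nbhdSeq c n) w

/-- The path `w` is at `c` at time `hitTime c w`, if this is finite. -/
def AttainsHit (c : M) (w : ℝ≥0 → M) : Prop := ∀ t : ℝ≥0, hitTime c w = t → w t = c

theorem measurable_hitTime [MeasurableSpace M] [OpensMeasurableSpace M] (c : M) :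
    Measurable (hitTime c) :=
  Measurable.iSup fun n => measurable_entryTime (isOpen_nbhdSeq c n)

theorem hitTime_le {c : M} {w : ℝ≥0 → M} (hw : IsRightContinuousPath w) {t : ℝ≥0}
    (ht : w t = c) : hitTime c w ≤ t :=
  iSup_le fun n => entryTime_le (isOpen_nbhdSeq c n) hw (ht ▸ mem_nbhdSeq c n)

/-- A path that approaches c enters every neighbourhood of c beforehand. Combined with `AttainsHit`,
this turns a left limit at c into an actual visit. -/
theorem hitTime_le_of_leftLimit {c : M} {w : ℝ≥0 → M} (hw : IsRightContinuousPath w) {t : ℝ≥0}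
    (h0 : 0 < t) (ht : Tendsto w (𝓝[<] t) (𝓝 c)) : hitTime c w ≤ t := by
  refine iSup_le fun n => ?_
  have h1 : ∀ᶠ s in 𝓝[<] t, w s ∈ nbhdSeq c n :=
    ht ((isOpen_nbhdSeq c n).mem_nhds (mem_nbhdSeq c n))
  have : (𝓝[<] t).NeBot := nhdsLT_neBot_of_exists_lt ⟨0, h0⟩
  obtain ⟨s, hs, hst⟩ := (h1.and self_mem_nhdsWithin).exists
  exact (entryTime_le (isOpen_nbhdSeq c n) hw hs).trans (ENNReal.coe_le_coe.2 (le_of_lt hst))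

theorem hitTime_le_add_shift (c : M) {w : ℝ≥0 → M} (hw : IsRightContinuousPath w) (u : ℝ≥0) :
    hitTime c w ≤ u + hitTime c (shiftPath u w) :=
  iSup_le fun n => (entryTime_le_add_shift (isOpen_nbhdSeq c n) hw u).trans
    (add_le_add le_rfl (le_iSup (fun n => entryTime (nbhdSeq c n) (shiftPath u w)) n))

/-- Attainment is needed for `≥` only: the shifted path really is at c at the remaining time. -/
theorem AttainsHit.hitTime_eq_add_shift {c : M} {w : ℝ≥0 → M} (h : AttainsHit c w)
    (hw : IsRightContinuousPath w) {u : ℝ≥0} (hu : (u : ℝ≥0∞) ≤ hitTime c w) :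
    hitTime c w = u + hitTime c (shiftPath u w) := by
  refine le_antisymm (hitTime_le_add_shift c hw u) ?_
  cases ht : hitTime c w with
  | top => exact le_top
  | coe t =>
    rw [ht, ENNReal.coe_le_coe] at hu
    have h1 : shiftPath u w (t - u) = c := by
      rw [shiftPath, add_tsub_cancel_of_le hu]; exact h t ht
    refine (add_le_add le_rfl (hitTime_le (hw.shift u) h1)).trans ?_
    rw [← ENNReal.coe_add, add_tsub_cancel_of_le hu]

end Paths


/-! ### Stopping times for right-continuous filtrations -/

theorem NNReal.not_withTop_top_lt_coe (i : ℝ≥0) : ¬(⊤ : WithTop ℝ≥0) < i := not_top_lt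

theorem NNReal.not_withTop_top_le_coe (i : ℝ≥0) : ¬(⊤ : WithTop ℝ≥0) ≤ i :=
  (WithTop.coe_lt_top i).not_ge

/-- Setting τ to `⊤` off s yields a stopping time, since right-continuity makes strict inequalities
sufficient; its defining events are those required of s. -/
theorem MeasureTheory.IsStoppingTime.measurableSet_of_inter_lt {Ω : Type*}
    {m : MeasurableSpace Ω} {f : Filtration ℝ≥0 m} [f.IsRightContinuous] {τ : Ω → WithTop ℝ≥0}
    (hτ : IsStoppingTime f τ) {s : Set Ω} (hs : MeasurableSet[⨆ t, f t] s)
    (h : ∀ i, MeasurableSet[f i] (s ∩ {ω | τ ω < i})) : MeasurableSet[hτ.measurableSpace] s := by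
  classical
  have h' : IsStoppingTime f fun ω => if ω ∈ s then τ ω else ⊤ := by
    refine isStoppingTime_of_measurableSet_lt_of_isRightContinuous fun i => ?_
    convert h i using 1
    ext ω
    by_cases hω : ω ∈ s
    · simp [hω]
    · simpa [hω] using NNReal.not_withTop_top_lt_coe i
  refine ⟨hs, fun i => ?_⟩
  convert h' i using 1
  ext ω
  by_cases hω : ω ∈ s
  · simp [hω]
  · simpa [hω] using NNReal.not_withTop_top_le_coe i

theorem MeasureTheory.IsStoppingTime.add_coe {Ω : Type*}
    {m : MeasurableSpace Ω} {f : Filtration ℝ≥0 m} {τ : Ω → WithTop ℝ≥0}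
    (hτ : IsStoppingTime f τ) (t : ℝ≥0) : IsStoppingTime f fun ω => τ ω + t := by
  intro i
  by_cases hti : t ≤ i
  · refine f.mono tsub_le_self _ (MeasurableSet.congr (hτ (i - t)) ?_)
    ext ω
    simp only [mem_ofPred_eq]
    cases h : τ ω with
    | top =>
      rw [top_add]
      exact iff_of_false (NNReal.not_withTop_top_le_coe (i - t)) (NNReal.not_withTop_top_le_coe i)
    | coe r => norm_cast; exact le_tsub_iff_right hti
  · convert @MeasurableSet.empty _ (f i)
    ext ω
    simp only [mem_ofPred_eq, mem_empty_iff_false, iff_false]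
    cases h : τ ω with
    | top => rw [top_add]; exact NNReal.not_withTop_top_le_coe i
    | coe r => norm_cast; exact fun h => hti (le_add_self.trans h)

/-! ### The state and the path at a stopping time -/

namespace HuntProcess

variable {S : Type*} [TopologicalSpace S] {Ω : Type*} [MeasurableSpace Ω] (H : HuntProcess S Ω)

instance (x : OnePoint S) : IsProbabilityMeasure (H.P x) := H.isProbabilityMeasure x

instance : H.𝓕.IsRightContinuous := H.rightContinuous_filtration

theorem measurable_X (t : ℝ≥0) : Measurable (H.X t) := (H.adapted t).mono (H.𝓕.le t) le_rfl

/-- The path of the process. -/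
def path (ω : Ω) : ℝ≥0 → OnePoint S := fun t => H.X t ω

theorem measurable_path : Measurable H.path := measurable_pi_lambda _ H.measurable_X

theorem isRightContinuousPath (ω : Ω) : IsRightContinuousPath (H.path ω) :=
  H.rightContinuous_path ω

theorem isStoppingTime_entryTime {G : Set (OnePoint S)} (hG : IsOpen G) :
    IsStoppingTime H.𝓕 (fun ω => (entryTime G (H.path ω) : ℝ≥0∞)) := by
  refine isStoppingTime_of_measurableSet_lt_of_isRightContinuous fun i => ?_
  have : {ω | (entryTime G (H.path ω) : ℝ≥0∞) < (i : ℝ≥0∞)} =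
      ⋃ n, ⋃ (_ : TopologicalSpace.denseSeq ℝ≥0 n < i),
        H.X (TopologicalSpace.denseSeq ℝ≥0 n) ⁻¹' G := by
    ext ω
    simp only [mem_ofPred_eq, entryTime_lt_iff_exists_denseSeq, ENNReal.coe_lt_coe, mem_iUnion,
      mem_preimage, exists_prop, path, and_comm]
  change MeasurableSet[H.𝓕 i] {ω | (entryTime G (H.path ω) : ℝ≥0∞) < (i : ℝ≥0∞)}
  rw [this]
  exact MeasurableSet.iUnion fun n => MeasurableSet.iUnion fun hn =>
    H.𝓕.mono hn.le _ (H.adapted _ hG.measurableSet)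

/-- The state at a random time, which is the cemetery if this time is infinite. -/
def stateAt (τ : Ω → WithTop ℝ≥0) (ω : Ω) : OnePoint S :=
  if τ ω = ⊤ then OnePoint.infty else H.X (τ ω).untopA ω

theorem stateAt_of_eq {τ : Ω → WithTop ℝ≥0} {ω : Ω} {t : ℝ≥0} (h : τ ω = t) :
    H.stateAt τ ω = H.X t ω := by
  rw [stateAt, if_neg (h ▸ WithTop.coe_ne_top), h]
  rfl

theorem stateAt_of_lt_top {τ : Ω → WithTop ℝ≥0} {ω : Ω} (h : τ ω < ⊤) :
    H.stateAt τ ω = H.X (τ ω).untopA ω := by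
  simp [stateAt, h.ne]

/-- The path from a random time on. -/
def pathFrom (τ : Ω → WithTop ℝ≥0) (ω : Ω) : ℝ≥0 → OnePoint S :=
  fun t => H.stateAt (fun ω => τ ω + t) ω

theorem pathFrom_of_eq {τ : Ω → WithTop ℝ≥0} {ω : Ω} {t : ℝ≥0} (h : τ ω = t) :
    H.pathFrom τ ω = shiftPath t (H.path ω) := by
  ext1 s
  rw [pathFrom, H.stateAt_of_eq (t := t + s) (by rw [h]; norm_cast)]
  rfl

variable [T3Space (OnePoint S)] [SecondCountableTopology (OnePoint S)]

/-- Right-continuity expresses the state at τ through countably many fixed times just after τ. The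
closed set `closure V` is used because membership then survives the limit from the right. -/
theorem stateAt_mem_iff {τ : Ω → WithTop ℝ≥0} {U : Set (OnePoint S)} (hU : IsOpen U) {ω : Ω}
    {t : ℝ≥0} :
    (H.stateAt τ ω ∈ U ∧ τ ω < t) ↔
      ∃ V ∈ TopologicalSpace.countableBasis (OnePoint S), closure V ⊆ U ∧
        ∃ p, (TopologicalSpace.denseSeq ℝ≥0 p) ≤ t ∧
          τ ω < (TopologicalSpace.denseSeq ℝ≥0 p) ∧
          ∀ q, TopologicalSpace.denseSeq ℝ≥0 q < TopologicalSpace.denseSeq ℝ≥0 p →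
            (τ ω < (TopologicalSpace.denseSeq ℝ≥0 q) →
              H.X (TopologicalSpace.denseSeq ℝ≥0 q) ω ∈ closure V) := by
  constructor
  · rintro ⟨h1, h2⟩
    cases hτ : τ ω with
    | top => exact absurd (hτ ▸ h2) (NNReal.not_withTop_top_lt_coe t)
    | coe s =>
      rw [H.stateAt_of_eq hτ] at h1
      rw [hτ] at h2
      norm_cast at h2
      obtain ⟨W, ⟨hW, hWc⟩, hWU⟩ := (closed_nhds_basis (H.X s ω)).mem_iff.1 (hU.mem_nhds h1)
      obtain ⟨V, hV, hsV, hVW⟩ :=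
        (TopologicalSpace.isBasis_countableBasis (OnePoint S)).mem_nhds_iff.1 hW
      obtain ⟨v, hsv, hv⟩ := (H.isRightContinuousPath ω).exists_gt
        ((TopologicalSpace.isOpen_of_mem_countableBasis hV).mem_nhds hsV)
      obtain ⟨p, hp1, hp2⟩ := exists_denseSeq_between (lt_min hsv h2)
      refine ⟨V, hV, (closure_minimal hVW hWc).trans hWU, p,
        (hp2.trans_le (min_le_right _ _)).le, by exact_mod_cast hp1, fun q hq hsq => ?_⟩
      norm_cast at hsq
      exact subset_closure (hv _ hsq.le (hq.trans (hp2.trans_le (min_le_left _ _))))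
  · rintro ⟨V, hV, hVU, p, hpt, hτp, hq⟩
    refine ⟨hVU ?_, hτp.trans_le (by exact_mod_cast hpt)⟩
    cases hτ : τ ω with
    | top => exact absurd (hτ ▸ hτp) (NNReal.not_withTop_top_lt_coe _)
    | coe s =>
      rw [H.stateAt_of_eq hτ]
      rw [hτ] at hτp
      simp only [hτ] at hq
      norm_cast at hτp hq
      by_contra hc
      obtain ⟨v, hsv, hv⟩ := (H.isRightContinuousPath ω).exists_gt
        (isClosed_closure.isOpen_compl.mem_nhds hc)
      obtain ⟨q, hq1, hq2⟩ := exists_denseSeq_between (lt_min hsv hτp)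
      exact hv _ hq1.le (hq2.trans_le (min_le_left _ _))
        (hq q (hq2.trans_le (min_le_right _ _)) hq1)

theorem measurable_stateAt {τ : Ω → WithTop ℝ≥0} (hτ : IsStoppingTime H.𝓕 τ) :
    Measurable[hτ.measurableSpace] (H.stateAt τ) := by
  have hlt : ∀ (U : Set (OnePoint S)), IsOpen U → ∀ t : ℝ≥0,
      MeasurableSet[H.𝓕 t] {ω | H.stateAt τ ω ∈ U ∧ τ ω < t} := by
    intro U hU t
    have : {ω | H.stateAt τ ω ∈ U ∧ τ ω < t} =
      ⋃ V ∈ TopologicalSpace.countableBasis (OnePoint S), ⋃ (_ : closure V ⊆ U),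
        ⋃ p, ⋃ (_ : TopologicalSpace.denseSeq ℝ≥0 p ≤ t),
          ({ω | τ ω < (TopologicalSpace.denseSeq ℝ≥0 p)} ∩
          ⋂ q, ⋂ (_ : TopologicalSpace.denseSeq ℝ≥0 q < TopologicalSpace.denseSeq ℝ≥0 p),
            ({ω | τ ω < (TopologicalSpace.denseSeq ℝ≥0 q)}ᶜ ∪
              H.X (TopologicalSpace.denseSeq ℝ≥0 q) ⁻¹' closure V)) := by
      ext ω
      simp only [mem_ofPred_eq, H.stateAt_mem_iff hU, mem_iUnion, mem_inter_iff, mem_iInter,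
        mem_union, mem_compl_iff, mem_preimage, exists_prop, imp_iff_not_or]
    rw [this]
    refine MeasurableSet.biUnion (TopologicalSpace.countable_countableBasis _) fun V _ =>
      MeasurableSet.iUnion fun _ => MeasurableSet.iUnion fun p => MeasurableSet.iUnion fun hp =>
        MeasurableSet.inter (H.𝓕.mono hp _ (hτ.measurableSet_lt _)) ?_
    refine MeasurableSet.iInter fun q => MeasurableSet.iInter fun hq => ?_
    exact ((H.𝓕.mono (hq.le.trans hp) _ (hτ.measurableSet_lt _)).compl).union
      (H.𝓕.mono (hq.le.trans hp) _ (H.adapted _ isClosed_closure.measurableSet))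
  refine @measurable_of_isOpen _ _ _ _ _ hτ.measurableSpace _ fun U hU => ?_
  -- Only finite τ needs an argument; for infinite τ the state is the cemetery by convention.
  have h1 : MeasurableSet[hτ.measurableSpace] {ω | H.stateAt τ ω ∈ U ∧ τ ω < ⊤} := by
    refine hτ.measurableSet_of_inter_lt ?_ fun i => ?_
    · have : {ω | H.stateAt τ ω ∈ U ∧ τ ω < ⊤} =
          ⋃ n : ℕ, {ω | H.stateAt τ ω ∈ U ∧ τ ω < ((n : ℝ≥0) : WithTop ℝ≥0)} := by
        ext ω
        simp only [mem_ofPred_eq, mem_iUnion, exists_and_left, and_congr_right_iff]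
        intro _
        cases h : τ ω with
        | top => simp
        | coe s =>
          simp only [WithTop.coe_lt_top, true_iff]
          obtain ⟨n, hn⟩ := exists_nat_gt s
          exact ⟨n, WithTop.coe_lt_coe.2 hn⟩
      rw [this]
      exact MeasurableSet.iUnion fun n => le_iSup (fun t => H.𝓕 t) (n : ℝ≥0) _ (hlt U hU n)
    · convert hlt U hU i using 1
      ext ω
      simp only [mem_inter_iff, mem_ofPred_eq]
      exact ⟨fun h => ⟨h.1.1, h.2⟩, fun h => ⟨⟨h.1, h.2.trans (WithTop.coe_lt_top _)⟩, h.2⟩⟩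
  have h2 : MeasurableSet[hτ.measurableSpace] {ω | OnePoint.infty ∈ U ∧ τ ω = ⊤} :=
    (@MeasurableSet.const _ hτ.measurableSpace _).inter 
      ((measurableSet_singleton (⊤ : WithTop ℝ≥0)).preimage hτ.measurable)
  convert h1.union h2 using 1
  ext ω
  by_cases h : τ ω = ⊤
  · simp [h, stateAt]
  · simp [h, lt_top_iff_ne_top]

theorem measurable_stateAt' {τ : Ω → WithTop ℝ≥0} (hτ : IsStoppingTime H.𝓕 τ) :
    Measurable (H.stateAt τ) :=
  (H.measurable_stateAt hτ).mono hτ.measurableSpace_le le_rfl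

theorem measurable_pathFrom {τ : Ω → WithTop ℝ≥0} (hτ : IsStoppingTime H.𝓕 τ) :
    Measurable (H.pathFrom τ) :=
  measurable_pi_lambda _ fun t => H.measurable_stateAt' (hτ.add_coe t)

end HuntProcess
-- The strong Markov property on path space
namespace HuntProcess

variable {S : Type*} [TopologicalSpace S] {Ω : Type*} [MeasurableSpace Ω] (H : HuntProcess S Ω)

theorem measurable_law_map (t : ℝ≥0) : Measurable fun y => (H.P y).map (H.X t) := by
  refine Measure.measurable_of_measurable_coe _ fun B hB => ?_
  simp_rw [Measure.map_apply (H.measurable_X t) hB]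
  exact H.measurable_law t B hB

theorem measurable_lintegral_law (t : ℝ≥0) {h : OnePoint S → ℝ≥0∞} (hh : Measurable h) :
    Measurable fun y => ∫⁻ ω, h (H.X t ω) ∂(H.P y) := by
  simp_rw [← lintegral_map hh (H.measurable_X t)]
  exact (Measure.measurable_lintegral hh).comp (H.measurable_law_map t)

theorem measurableSet_lt_top {τ : Ω → WithTop ℝ≥0} (hτ : IsStoppingTime H.𝓕 τ) :
    MeasurableSet[hτ.measurableSpace] {ω | τ ω < ⊤} := by
  have h : MeasurableSet[hτ.measurableSpace] {ω | τ ω = ⊤} :=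
    (measurableSet_singleton (⊤ : WithTop ℝ≥0)).preimage hτ.measurable
  convert h.compl using 1
  ext ω
  exact lt_top_iff_ne_top (a := τ ω)

variable [T3Space (OnePoint S)] [SecondCountableTopology (OnePoint S)]

/-- The strong Markov property for functions of the state. -/
theorem setLIntegral_stateAt_add {τ : Ω → WithTop ℝ≥0} (hτ : IsStoppingTime H.𝓕 τ)
    (x : OnePoint S) (t : ℝ≥0) {A : Set Ω} (hA : MeasurableSet[hτ.measurableSpace] A)
    {h : OnePoint S → ℝ≥0∞} (hh : Measurable h) :
    ∫⁻ ω in A ∩ {ω | τ ω < ⊤}, h (H.stateAt (fun ω => τ ω + t) ω) ∂(H.P x) =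
      ∫⁻ ω in A ∩ {ω | τ ω < ⊤}, ∫⁻ ω', h (H.X t ω') ∂(H.P (H.stateAt τ ω)) ∂(H.P x) := by
  have hAm : MeasurableSet (A ∩ {ω | τ ω < ⊤}) :=
    hτ.measurableSpace_le _ (hA.inter (H.measurableSet_lt_top hτ))
  have hm := H.measurable_stateAt' hτ
  have hmt := H.measurable_stateAt' (hτ.add_coe t)
  have hk : AEMeasurable (fun ω => (H.P (H.stateAt τ ω)).map (H.X t))
      ((H.P x).restrict (A ∩ {ω | τ ω < ⊤})) := ((H.measurable_law_map t).comp hm).aemeasurable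
  -- The Markov property for sets is an identity of measures, which can then be integrated against
  -- any h.
  have key : ((H.P x).restrict (A ∩ {ω | τ ω < ⊤})).map (H.stateAt fun ω => τ ω + t) =
      ((H.P x).restrict (A ∩ {ω | τ ω < ⊤})).bind
        fun ω => (H.P (H.stateAt τ ω)).map (H.X t) := by
    ext B hB
    rw [Measure.map_apply hmt hB, Measure.restrict_apply (hmt hB),
      Measure.bind_apply hB hk]
    have h1 := H.strongMarkov τ hτ x t B hB A hA
    have h2 : A ∩ {ω | τ ω < ⊤ ∧ H.X ((τ ω).untopA + t) ω ∈ B} =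
        (H.stateAt fun ω => τ ω + t) ⁻¹' B ∩ (A ∩ {ω | τ ω < ⊤}) := by
      ext ω
      simp only [mem_inter_iff, mem_ofPred_eq, mem_preimage]
      by_cases hω : τ ω < ⊤
      · obtain ⟨s, hs⟩ := WithTop.ne_top_iff_exists.1 hω.ne
        rw [H.stateAt_of_eq (t := s + t) (by rw [← hs]; norm_cast)]
        have : (τ ω).untopA = s := by rw [← hs]; rfl
        rw [this]; tauto
      · tauto
    rw [← h2, h1]
    refine setLIntegral_congr_fun hAm fun ω hω => ?_
    rw [Measure.map_apply (H.measurable_X t) hB, H.stateAt_of_lt_top hω.2]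
    rfl
  rw [← lintegral_map hh hmt, key, Measure.lintegral_bind hk hh.aemeasurable]
  simp_rw [lintegral_map hh (H.measurable_X t)]

/-- The Markov property for finite-dimensional cylinders. -/
theorem strongMarkov_cylinder (n : ℕ) : ∀ (I : Finset ℝ≥0), I.card = n →
    ∀ B : ℝ≥0 → Set (OnePoint S), (∀ i, MeasurableSet (B i)) →
    (Measurable fun y => H.P y {ω | H.path ω ∈ (I : Set ℝ≥0).pi B}) ∧
    ∀ (τ : Ω → WithTop ℝ≥0) (hτ : IsStoppingTime H.𝓕 τ) (x : OnePoint S) (A : Set Ω),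
      MeasurableSet[hτ.measurableSpace] A →
      H.P x ((A ∩ {ω | τ ω < ⊤}) ∩ {ω | H.pathFrom τ ω ∈ (I : Set ℝ≥0).pi B}) =
        ∫⁻ ω in A ∩ {ω | τ ω < ⊤},
          H.P (H.stateAt τ ω) {ω' | H.path ω' ∈ (I : Set ℝ≥0).pi B} ∂(H.P x) := by
  classical
  induction n using Nat.strong_induction_on with
  | _ n ih =>
  intro I hI B hB
  rcases I.eq_empty_or_nonempty with rfl | hne
  · simp
  -- The earliest time m is split off and the later ones are translated by m, so that the induction
  -- hypothesis applies at τ + m.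
  set m := I.min' hne with hm
  set J := (I.erase m).image (fun j => j - m) with hJ
  have hmI : m ∈ I := I.min'_mem hne
  have hJc : J.card < n :=
    Finset.card_image_le.trans_lt (hI ▸ Finset.card_erase_lt_of_mem hmI)
  obtain ⟨ih1, ih2⟩ := ih J.card hJc J rfl (fun j => B (m + j)) fun j => hB _
  set C := (I : Set ℝ≥0).pi B with hC
  set C' := (J : Set ℝ≥0).pi fun j => B (m + j) with hC'
  have hsplit : ∀ w : ℝ≥0 → OnePoint S, w ∈ C ↔ w m ∈ B m ∧ shiftPath m w ∈ C' := by
    intro w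
    constructor
    · intro hw
      refine ⟨hw m hmI, fun j hj => ?_⟩
      obtain ⟨i, hi, rfl⟩ := Finset.mem_image.1 hj
      have hmi : m ≤ i := I.min'_le i (Finset.mem_of_mem_erase hi)
      simp only [shiftPath, add_tsub_cancel_of_le hmi]
      exact hw i (Finset.mem_of_mem_erase hi)
    · rintro ⟨h1, h2⟩ i hi
      by_cases him : i = m
      · exact him ▸ h1
      · have hmi : m ≤ i := I.min'_le i hi
        have := h2 (i - m) (Finset.mem_image_of_mem _ (Finset.mem_erase.2 ⟨him, hi⟩))
        simpa only [shiftPath, add_tsub_cancel_of_le hmi] using this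
  have hsplit' : ∀ (τ : Ω → WithTop ℝ≥0) ω, H.pathFrom τ ω ∈ C ↔
      H.stateAt (fun ω => τ ω + m) ω ∈ B m ∧ H.pathFrom (fun ω => τ ω + m) ω ∈ C' := by
    intro τ ω
    rw [hsplit]
    have : shiftPath m (H.pathFrom τ ω) = H.pathFrom (fun ω => τ ω + m) ω := by
      ext1 j
      simp only [shiftPath, pathFrom, WithTop.coe_add, add_assoc]
    rw [this]
    rfl
  -- h(y) is the probability from y of meeting the remaining conditions, provided y satisfies the
  -- condition at time m.
  set h : OnePoint S → ℝ≥0∞ := (B m).indicator fun y => H.P y {ω | H.path ω ∈ C'} with hh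
  have hhm : Measurable h := ih1.indicator (hB m)
  have key : ∀ (τ : Ω → WithTop ℝ≥0) (hτ : IsStoppingTime H.𝓕 τ) (x : OnePoint S) (A : Set Ω),
      MeasurableSet[hτ.measurableSpace] A →
      H.P x ((A ∩ {ω | τ ω < ⊤}) ∩ {ω | H.pathFrom τ ω ∈ C}) =
        ∫⁻ ω in A ∩ {ω | τ ω < ⊤}, h (H.stateAt (fun ω => τ ω + m) ω) ∂(H.P x) := by
    intro τ hτ x A hA
    have hτm := hτ.add_coe m
    have hsm := H.measurable_stateAt hτm
    have hle : hτ.measurableSpace ≤ hτm.measurableSpace :=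
      hτ.measurableSpace_mono hτm fun ω => le_self_add
    have hA' : MeasurableSet[hτm.measurableSpace]
        ((A ∩ {ω | τ ω < ⊤}) ∩ (H.stateAt fun ω => τ ω + m) ⁻¹' B m) :=
      (hle _ (hA.inter (H.measurableSet_lt_top hτ))).inter (hsm (hB m))
    have h1 := ih2 _ hτm x _ hA'
    have hset : ((A ∩ {ω | τ ω < ⊤}) ∩ (H.stateAt fun ω => τ ω + m) ⁻¹' B m) ∩
        {ω | τ ω + m < ⊤} = (H.stateAt fun ω => τ ω + m) ⁻¹' B m ∩ (A ∩ {ω | τ ω < ⊤}) := by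
      ext ω
      simp only [mem_inter_iff, mem_ofPred_eq, mem_preimage]
      have : τ ω < ⊤ → τ ω + m < ⊤ := fun h =>
        WithTop.add_lt_top.2 ⟨h, WithTop.coe_lt_top _⟩
      tauto
    rw [hset] at h1
    rw [← setLIntegral_indicator ((H.measurable_stateAt' hτm) (hB m))] at h1
    have h3 : (A ∩ {ω | τ ω < ⊤}) ∩ {ω | H.pathFrom τ ω ∈ C} =
        (H.stateAt fun ω => τ ω + m) ⁻¹' B m ∩ (A ∩ {ω | τ ω < ⊤}) ∩
          {ω | H.pathFrom (fun ω => τ ω + m) ω ∈ C'} := by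
      ext ω
      simp only [mem_inter_iff, mem_ofPred_eq, mem_preimage, hsplit']
      tauto
    rw [h3, h1]
    rfl
  -- The case τ = 0 of `key`.
  have hval : ∀ y, H.P y {ω | H.path ω ∈ C} = ∫⁻ ω, h (H.X m ω) ∂(H.P y) := by
    intro y
    have h1 := key (fun _ => ((0 : ℝ≥0) : WithTop ℝ≥0)) (isStoppingTime_const _ _) y univ
      MeasurableSet.univ
    have h2 : (univ ∩ {ω : Ω | ((0 : ℝ≥0) : WithTop ℝ≥0) < ⊤}) = univ := by
      ext ω; simp
    rw [h2, univ_inter, Measure.restrict_univ] at h1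
    have h4 : ∀ ω, H.pathFrom (fun _ => ((0 : ℝ≥0) : WithTop ℝ≥0)) ω = H.path ω := by
      intro ω
      rw [H.pathFrom_of_eq (t := 0) rfl]
      ext1 s; simp [shiftPath]
    have h5 : ∀ ω, H.stateAt (fun _ => ((0 : ℝ≥0) : WithTop ℝ≥0) + (m : WithTop ℝ≥0)) ω =
        H.X m ω := fun ω => H.stateAt_of_eq (by norm_cast; simp)
    simp_rw [h4, h5] at h1
    exact h1
  refine ⟨?_, fun τ hτ x A hA => ?_⟩
  · simp_rw [hval]
    exact H.measurable_lintegral_law m hhm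
  · rw [key τ hτ x A hA, H.setLIntegral_stateAt_add hτ x m hA hhm]
    simp_rw [hval]

theorem measurable_law_path : Measurable fun y => (H.P y).map H.path := by
  have : ∀ y, IsProbabilityMeasure ((H.P y).map H.path) := fun y =>
    Measure.isProbabilityMeasure_map H.measurable_path.aemeasurable
  refine Measurable.measure_of_isPiSystem_of_isProbabilityMeasure
    (generateFrom_squareCylinders (α := fun _ : ℝ≥0 => OnePoint S)).symm
    (isPiSystem_squareCylinders (fun _ => MeasurableSpace.isPiSystem_measurableSet) (by simp)) ?_
  rintro _ ⟨I, B, hB, rfl⟩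
  have hB' : ∀ i, MeasurableSet (B i) := fun i => hB i (mem_univ i)
  have hm : MeasurableSet ((I : Set ℝ≥0).pi B) :=
    MeasurableSet.pi I.countable_toSet fun i _ => hB' i
  simp_rw [Measure.map_apply H.measurable_path hm]
  exact (H.strongMarkov_cylinder _ I rfl B hB').1

/-- The strong Markov property for events depending on the whole path. -/
theorem strongMarkov_path {τ : Ω → WithTop ℝ≥0} (hτ : IsStoppingTime H.𝓕 τ) (x : OnePoint S)
    {A : Set Ω} (hA : MeasurableSet[hτ.measurableSpace] A) {C : Set (ℝ≥0 → OnePoint S)}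
    (hC : MeasurableSet C) :
    H.P x ((A ∩ {ω | τ ω < ⊤}) ∩ {ω | H.pathFrom τ ω ∈ C}) =
      ∫⁻ ω in A ∩ {ω | τ ω < ⊤}, H.P (H.stateAt τ ω) {ω' | H.path ω' ∈ C} ∂(H.P x) := by
  have hm := H.measurable_pathFrom hτ
  have hk : Measurable fun ω => (H.P (H.stateAt τ ω)).map H.path :=
    H.measurable_law_path.comp (H.measurable_stateAt' hτ)
  have happ : ∀ C : Set (ℝ≥0 → OnePoint S), MeasurableSet C →
      ((H.P x).restrict (A ∩ {ω | τ ω < ⊤})).map (H.pathFrom τ) C =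
        H.P x ((A ∩ {ω | τ ω < ⊤}) ∩ {ω | H.pathFrom τ ω ∈ C}) := fun C hC => by
    rw [Measure.map_apply hm hC, Measure.restrict_apply (hm hC), inter_comm]
    rfl
  have happ' : ∀ C : Set (ℝ≥0 → OnePoint S), MeasurableSet C →
      ((H.P x).restrict (A ∩ {ω | τ ω < ⊤})).bind (fun ω => (H.P (H.stateAt τ ω)).map H.path) C =
        ∫⁻ ω in A ∩ {ω | τ ω < ⊤}, H.P (H.stateAt τ ω) {ω' | H.path ω' ∈ C} ∂(H.P x) :=
    fun C hC => by
      rw [Measure.bind_apply hC hk.aemeasurable]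
      simp_rw [Measure.map_apply H.measurable_path hC]
      rfl
  rw [← happ C hC, ← happ' C hC]
  congr 1
  have hfin : IsFiniteMeasure (((H.P x).restrict (A ∩ {ω | τ ω < ⊤})).map (H.pathFrom τ)) :=
    Measure.isFiniteMeasure_map _ _
  have hcyl : ∀ (I : Finset ℝ≥0) (B : ℝ≥0 → Set (OnePoint S)), (∀ i, MeasurableSet (B i)) →
      ((H.P x).restrict (A ∩ {ω | τ ω < ⊤})).map (H.pathFrom τ) ((I : Set ℝ≥0).pi B) =
      ((H.P x).restrict (A ∩ {ω | τ ω < ⊤})).bind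
        (fun ω => (H.P (H.stateAt τ ω)).map H.path) ((I : Set ℝ≥0).pi B) := by
    intro I B hB
    have hm : MeasurableSet ((I : Set ℝ≥0).pi B) :=
      MeasurableSet.pi I.countable_toSet fun i _ => hB i
    rw [happ _ hm, happ' _ hm]
    exact (H.strongMarkov_cylinder _ I rfl B hB).2 τ hτ x A hA
  refine ext_of_generate_finite _
    (generateFrom_squareCylinders (α := fun _ : ℝ≥0 => OnePoint S)).symm
    (isPiSystem_squareCylinders (fun _ => MeasurableSpace.isPiSystem_measurableSet) (by simp)) ?_ ?_
  · rintro _ ⟨I, B, hB, rfl⟩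
    exact hcyl I B fun i => hB i (mem_univ i)
  -- The empty cylinder is the whole space, so it compares the total masses.
  · simpa using hcyl ∅ (fun _ => univ) fun _ => MeasurableSet.univ

/-- The hitting time of `c`, as a stopping time. -/
def hitStop (c : OnePoint S) : Ω → WithTop ℝ≥0 := fun ω => hitTime c (H.path ω)

theorem isStoppingTime_hitStop (c : OnePoint S) : IsStoppingTime H.𝓕 (H.hitStop c) := by
  intro i
  have : {ω | H.hitStop c ω ≤ i} =
      ⋂ n, {ω | (entryTime (nbhdSeq c n) (H.path ω) : ℝ≥0∞) ≤ (i : ℝ≥0∞)} := by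
    ext ω
    simp only [mem_iInter, mem_ofPred_eq]
    exact iSup_le_iff (f := fun n => entryTime (nbhdSeq c n) (H.path ω))
  rw [this]
  exact MeasurableSet.iInter fun n => H.isStoppingTime_entryTime (isOpen_nbhdSeq c n) i

/-- Almost surely the path is at `c` at the hitting time of `c`. -/
theorem ae_attainsHit (x c : OnePoint S) : ∀ᵐ ω ∂(H.P x), AttainsHit c (H.path ω) := by
  have h := H.quasiLeftContinuous (fun n ω => (entryTime (nbhdSeq c n) (H.path ω) : ℝ≥0∞))
    (fun n => H.isStoppingTime_entryTime (isOpen_nbhdSeq c n))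
    (fun ω n m hnm => entryTime_anti (nbhdSeq_antitone c hnm) _) x
  filter_upwards [h] with ω hω t ht
  have ht' : (⨆ n, (entryTime (nbhdSeq c n) (H.path ω) : WithTop ℝ≥0)) = (t : WithTop ℝ≥0) := ht
  have h1 := hω (ht' ▸ WithTop.coe_lt_top t)
  have h2 : (⨆ n, (entryTime (nbhdSeq c n) (H.path ω) : WithTop ℝ≥0)).untopA = t := by
    rw [ht']; rfl
  have h3 : Tendsto (fun n => H.X (WithTop.untopA (entryTime (nbhdSeq c n) (H.path ω))) ω) atTop
      (𝓝 (H.X t ω)) :=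
    Eq.subst (motive := fun s => Tendsto _ atTop (𝓝 (H.X s ω))) h2 h1
  -- At the k-th entry time the path is in the closure of the k-th neighbourhood, so these states
  -- converge to c as well as to the state at t.
  refine tendsto_nhds_unique h3 ?_
  refine tendsto_def.2 fun U hU => ?_
  obtain ⟨n, hn⟩ := exists_closure_nbhdSeq_subset hU
  refine mem_atTop_sets.2 ⟨n, fun k hk => hn (closure_mono (nbhdSeq_antitone c hk) ?_)⟩
  have hle : entryTime (nbhdSeq c k) (H.path ω) ≤ t :=
    ht ▸ le_iSup (fun n => entryTime (nbhdSeq c n) (H.path ω)) k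
  obtain ⟨s, hs⟩ := WithTop.ne_top_iff_exists.1
    (hle.trans_lt ENNReal.coe_lt_top).ne
  have : WithTop.untopA (entryTime (nbhdSeq c k) (H.path ω) : WithTop ℝ≥0) = s := by
    rw [← hs]; rfl
  refine Eq.subst (motive := fun s => H.X s ω ∈ closure (nbhdSeq c k)) this.symm ?_
  exact mem_closure_of_entryTime_eq (H.isRightContinuousPath ω) hs.symm

/-- The strong Markov property at the hitting time of a point: the process starts afresh. -/
theorem strongMarkov_hitStop (x c : OnePoint S) {A : Set Ω}
    (hA : MeasurableSet[(H.isStoppingTime_hitStop c).measurableSpace] A)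
    {C : Set (ℝ≥0 → OnePoint S)} (hC : MeasurableSet C) :
    H.P x ((A ∩ {ω | hitTime c (H.path ω) < ∞}) ∩
        {ω | shiftPath (hitTime c (H.path ω)).toNNReal (H.path ω) ∈ C}) =
      H.P x (A ∩ {ω | hitTime c (H.path ω) < ∞}) * H.P c {ω | H.path ω ∈ C} := by
  have h := H.strongMarkov_path (H.isStoppingTime_hitStop c) x hA hC
  have hAm : MeasurableSet (A ∩ {ω | H.hitStop c ω < ⊤}) :=
    (H.isStoppingTime_hitStop c).measurableSpace_le _
      (hA.inter (H.measurableSet_lt_top (H.isStoppingTime_hitStop c)))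
  -- The state at the hitting time is a.s. c, so the integrand is constant.
  have h1 : ∫⁻ ω in A ∩ {ω | H.hitStop c ω < ⊤},
      H.P (H.stateAt (H.hitStop c) ω) {ω' | H.path ω' ∈ C} ∂(H.P x) =
      ∫⁻ ω in A ∩ {ω | H.hitStop c ω < ⊤}, H.P c {ω' | H.path ω' ∈ C} ∂(H.P x) := by
    refine setLIntegral_congr_fun_ae hAm ?_
    filter_upwards [H.ae_attainsHit x c] with ω hω hωA
    obtain ⟨t, ht⟩ := WithTop.ne_top_iff_exists.1 
      (show H.hitStop c ω < ⊤ from hωA.2).ne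
    rw [H.stateAt_of_eq ht.symm, show H.X t ω = c from hω t ht.symm]
  rw [h1, setLIntegral_const, mul_comm] at h
  have h2 : (A ∩ {ω | hitTime c (H.path ω) < ∞}) ∩
        {ω | shiftPath (hitTime c (H.path ω)).toNNReal (H.path ω) ∈ C} =
      (A ∩ {ω | H.hitStop c ω < ⊤}) ∩ {ω | H.pathFrom (H.hitStop c) ω ∈ C} := by
    ext ω
    refine and_congr_right fun hω => ?_
    obtain ⟨t, ht⟩ := WithTop.ne_top_iff_exists.1
      (show hitTime c (H.path ω) < ∞ from hω.2).ne
    simp only [mem_ofPred_eq]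
    rw [H.pathFrom_of_eq (t := t) ht.symm, ← ht]
    rfl
  rw [h2, h]
  rfl

end HuntProcess

/-- `y` lies strictly between `a` and `b`. -/
def StrictlyBetween {α : Type*} [LinearOrder α] (a y b : α) : Prop :=
  (a < y ∧ y < b) ∨ (b < y ∧ y < a)

theorem StrictlyBetween.mem_Ioo {α : Type*} [LinearOrder α] {a y b : α}
    (h : StrictlyBetween a y b) : y ∈ Ioo (min a b) (max a b) := by
  rcases h with h | h
  · exact ⟨(min_le_left _ _).trans_lt h.1, h.2.trans_le (le_max_right _ _)⟩
  · exact ⟨(min_le_right _ _).trans_lt h.1, h.2.trans_le (le_max_left _ _)⟩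

theorem StrictlyBetween.symm {α : Type*} [LinearOrder α] {a y b : α}
    (h : StrictlyBetween a y b) : StrictlyBetween b y a := Or.symm h

theorem StrictlyBetween.ne_left {α : Type*} [LinearOrder α] {a y b : α}
    (h : StrictlyBetween a y b) : y ≠ a := by
  rcases h with h | h
  · exact h.1.ne'
  · exact h.2.ne

theorem StrictlyBetween.ne_right {α : Type*} [LinearOrder α] {a y b : α}
    (h : StrictlyBetween a y b) : y ≠ b := h.symm.ne_left

theorem StrictlyBetween.ne {α : Type*} [LinearOrder α] {a y b : α}
    (h : StrictlyBetween a y b) : a ≠ b := by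
  rcases h with h | h
  · exact (h.1.trans h.2).ne
  · exact (h.1.trans h.2).ne'

/-! ### Paths without skips -/

namespace HuntProcess

section General

variable {S : Type*} [TopologicalSpace S] {Ω : Type*} [MeasurableSpace Ω] (H : HuntProcess S Ω)

/-- The cemetery is a trap, so it has not been reached by time s; as E is open in the
compactification, right-continuity keeps the path in E for a while longer, which makes the
inequality strict. -/
theorem lt_lifetime {ω : Ω} {s : ℝ≥0} (h : H.X s ω ≠ OnePoint.infty) :
    (s : ℝ≥0∞) < H.lifetime ω := by
  have hU : range ((↑) : S → OnePoint S) ∈ 𝓝 (H.path ω s) := by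
    refine OnePoint.isOpen_range_coe.mem_nhds ?_
    obtain ⟨z, hz⟩ := OnePoint.ne_infty_iff_exists.1 h
    exact ⟨z, hz⟩
  obtain ⟨v, hsv, hv⟩ := (H.isRightContinuousPath ω).exists_gt hU
  refine (ENNReal.coe_lt_coe.2 hsv).trans_le (le_iInf₂ fun t ht => ?_)
  rw [ENNReal.coe_le_coe]
  by_contra! htv
  rcases le_total t s with hts | hst
  · exact h (H.absorbed t s ω hts ht.2)
  · obtain ⟨z, hz⟩ := hv t hst htv
    exact OnePoint.coe_ne_infty z (hz.trans ht.2)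

theorem lifetime_eq {ω : Ω} {s : ℝ≥0} (hs : 0 < s) (h : H.X s ω = OnePoint.infty)
    (h' : ∀ u < s, H.X u ω ≠ OnePoint.infty) : H.lifetime ω = s := by
  refine le_antisymm (iInf₂_le s ⟨hs, h⟩) (le_iInf₂ fun t ht => ?_)
  rw [ENNReal.coe_le_coe]
  by_contra! hts
  exact h' t hts ht.2

/-- `hit` ignores time 0 whereas `hitTime` does not, hence the condition on the starting point. -/
theorem hit_eq_hitTime [FirstCountableTopology (OnePoint S)] {c : OnePoint S} {ω : Ω}
    (h0 : H.X 0 ω ≠ c) (hc : AttainsHit c (H.path ω)) : H.hit c ω = hitTime c (H.path ω) := by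
  refine le_antisymm ?_ (le_iInf₂ fun t ht => hitTime_le (H.isRightContinuousPath ω) ht.2)
  cases ht : hitTime c (H.path ω) with
  | top => exact le_top
  | coe t =>
    have h := hc t ht
    refine iInf₂_le t ⟨pos_iff_ne_zero.2 ?_, h⟩
    rintro rfl
    exact h0 h

end General

variable {E : Set EReal} {Ω : Type*} [MeasurableSpace Ω] (H : HuntProcess E Ω)

/-- The pathwise properties of skip-free processes: no skips, the cemetery is not reached by
a jump, and there is no explosion before the lifetime. -/
structure IsSkipFreePath [FirstCountableTopology (OnePoint E)] (ω : Ω) : Prop where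
  skipFree : ∀ t : ℝ≥0, 0 < t → (t : ℝ≥0∞) < H.lifetime ω →
    ∀ y z : E, H.HasLeftLimit ω t y → H.X t ω = z → Ioo (min y z) (max y z) = ∅
  attainsHit_infty : AttainsHit OnePoint.infty (H.path ω)
  leftLimit_lifetime : ∀ t : ℝ≥0, H.lifetime ω = t → H.HasLeftLimit ω t OnePoint.infty

variable {H}

theorem IsSkipFree.ae_isSkipFreePath [T3Space (OnePoint E)] [SecondCountableTopology (OnePoint E)]
    (hH : H.IsSkipFree) (x : E) : ∀ᵐ ω ∂(H.P x), H.IsSkipFreePath ω := by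
  have h3 : ∀ᵐ ω ∂(H.P x), ∀ t : ℝ≥0, H.lifetime ω = t →
      H.HasLeftLimit ω t OnePoint.infty := by
    by_cases h : 0 < H.P x {ω | H.lifetime ω < ∞}
    · filter_upwards [(hH.noKillingInside x h).2] with ω hω t ht
      obtain ⟨y, hy, hyr⟩ := hω t ht
      have : y = OnePoint.infty := by
        by_contra hne
        obtain ⟨z, hz⟩ := OnePoint.ne_infty_iff_exists.1 hne
        exact hyr ⟨z, hz⟩
      exact this ▸ hy
    · have h0 : H.P x {ω | H.lifetime ω < ∞} = 0 := by simpa using h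
      filter_upwards [measure_eq_zero_iff_ae_notMem.1 h0] with ω hω t ht
      exact absurd (ht ▸ ENNReal.coe_lt_top : H.lifetime ω < ∞) hω
  filter_upwards [hH.skipFree x, H.ae_attainsHit x OnePoint.infty, h3] with ω h1 h2 h3
  exact ⟨h1, h2, h3⟩

variable [FirstCountableTopology (OnePoint E)]

/-- A skip-free path leaves an open set `I` through a set `F` that separates `I` from the
rest of the state space, or else into the cemetery. -/
theorem IsSkipFreePath.exists_exit {ω : Ω} (hω : H.IsSkipFreePath ω) {I F : Set E}
    (hI : IsOpen I) (hcl : closure I ⊆ I ∪ F)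
    (hgap : ∀ p ∈ I, ∀ q, q ∉ I → q ∉ F → (Ioo (min p q) (max p q)).Nonempty)
    (hF : ∀ f ∈ F, AttainsHit (f : OnePoint E) (H.path ω))
    (h0 : H.X 0 ω ∈ ((↑) : E → OnePoint E) '' I) {t : ℝ≥0}
    (ht : H.X t ω ∉ ((↑) : E → OnePoint E) '' I) :
    ∃ s ≤ t, (∃ f ∈ F, H.X s ω = f) ∨
      (H.X s ω = OnePoint.infty ∧ ∀ u < s, H.X u ω ∈ ((↑) : E → OnePoint E) '' I) := by
  set D := {u : ℝ≥0 | H.X u ω ∉ ((↑) : E → OnePoint E) '' I} with hD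
  set s := sInf D with hs
  have hrc := H.isRightContinuousPath ω
  have hlt : ∀ u < s, H.X u ω ∈ ((↑) : E → OnePoint E) '' I := fun u hu => by
    by_contra h
    exact notMem_of_lt_csInf hu (OrderBot.bddBelow D) h
  have hst : s ≤ t := csInf_le (OrderBot.bddBelow D) ht
  have hsD : H.X s ω ∉ ((↑) : E → OnePoint E) '' I := by
    intro h
    obtain ⟨v, hsv, hv⟩ := hrc.exists_gt ((OnePoint.isOpenMap_coe I hI).mem_nhds h)
    refine hsv.not_ge (le_csInf ⟨t, ht⟩ fun u hu => ?_)
    by_contra! huv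
    exact hu (hv u (csInf_le (OrderBot.bddBelow D) hu) huv)
  have hs0 : 0 < s := by
    refine pos_iff_ne_zero.2 fun h => hsD ?_
    rw [h]; exact h0
  obtain ⟨y, hy⟩ := H.exists_leftLimit ω s hs0
  have hit : ∀ c : OnePoint E, AttainsHit c (H.path ω) → H.HasLeftLimit ω s c →
      ∃ u ≤ s, H.X u ω = c := by
    intro c hc hl
    have hle := hitTime_le_of_leftLimit hrc hs0 hl
    obtain ⟨u, hu⟩ := WithTop.ne_top_iff_exists.1 (hle.trans_lt ENNReal.coe_lt_top).ne
    exact ⟨u, ENNReal.coe_le_coe.1 (hu.trans_le hle), hc u hu.symm⟩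
  -- Cases for the left limit at the exit time s: at the cemetery or in F, the limit has been
  -- visited by time s; in I, a jump over a gap point is forbidden, so it ends in F or at the
  -- cemetery.
  induction y using OnePoint.rec with
  | infty =>
    obtain ⟨u, hus, hu⟩ := hit _ hω.attainsHit_infty hy
    exact ⟨s, hst, Or.inr ⟨H.absorbed u s ω hus hu, hlt⟩⟩
  | coe y =>
    have hycl : y ∈ closure I := by
      rw [OnePoint.isOpenEmbedding_coe.isInducing.closure_eq_preimage_closure_image]
      have : (𝓝[<] s).NeBot := nhdsLT_neBot_of_exists_lt ⟨0, hs0⟩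
      refine mem_closure_of_tendsto hy ?_
      filter_upwards [self_mem_nhdsWithin] with u hu
      exact hlt u hu
    rcases hcl hycl with hyI | hyF
    · rcases eq_or_ne (H.X s ω) OnePoint.infty with h | h
      · exact ⟨s, hst, Or.inr ⟨h, hlt⟩⟩
      · obtain ⟨q, hq⟩ := OnePoint.ne_infty_iff_exists.1 h
        by_cases hqF : q ∈ F
        · exact ⟨s, hst, Or.inl ⟨q, hqF, hq.symm⟩⟩
        · have hqI : q ∉ I := fun hqI => hsD ⟨q, hqI, hq⟩
          have h1 := hω.skipFree s hs0 (H.lt_lifetime h) y q hy hq.symm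
          exact absurd h1 (hgap y hyI q hqI hqF).ne_empty
    · obtain ⟨u, hus, hu⟩ := hit _ (hF y hyF) hy
      exact ⟨u, hus.trans hst, Or.inl ⟨y, hyF, hu⟩⟩

/-- A skip-free path cannot pass over a point. -/
theorem IsSkipFreePath.hitTime_lt {ω : Ω} (hω : H.IsSkipFreePath ω) {a y b : E}
    (hy : AttainsHit (y : OnePoint E) (H.path ω)) (hayb : StrictlyBetween a y b)
    (h0 : H.X 0 ω = a) {t : ℝ≥0} (ht : H.X t ω = b) :
    hitTime (y : OnePoint E) (H.path ω) < t := by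
  have hrc := H.isRightContinuousPath ω
  have hF : ∀ f ∈ ({y} : Set E), AttainsHit (f : OnePoint E) (H.path ω) := by
    rintro f rfl; exact hy
  have main : ∃ s ≤ t, (∃ f ∈ ({y} : Set E), H.X s ω = f) ∨ H.X s ω = OnePoint.infty := by
    rcases hayb with h | h
    · obtain ⟨s, hs, hs'⟩ := hω.exists_exit (I := Iio y) (F := {y}) isOpen_Iio
        (fun z hz => by
          have : z ≤ y := closure_minimal (t := Iic y) Iio_subset_Iic_self isClosed_Iic hz
          rcases this.lt_or_eq with h | h
          · exact Or.inl h
          · exact Or.inr h)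
        (fun p hp q hq hqy => ⟨y, StrictlyBetween.mem_Ioo
          (Or.inl ⟨hp, lt_of_le_of_ne (not_lt.1 hq) (Ne.symm hqy)⟩)⟩) hF
        ⟨a, h.1, h0.symm⟩ (t := t) (by
          rintro ⟨z, hz, hz'⟩
          rw [ht, OnePoint.coe_eq_coe] at hz'
          exact lt_asymm h.2 (hz' ▸ hz))
      exact ⟨s, hs, hs'.imp_right And.left⟩
    · obtain ⟨s, hs, hs'⟩ := hω.exists_exit (I := Ioi y) (F := {y}) isOpen_Ioi
        (fun z hz => by
          have : y ≤ z := closure_minimal (t := Ici y) Ioi_subset_Ici_self isClosed_Ici hz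
          rcases this.lt_or_eq with h | h
          · exact Or.inl h
          · exact Or.inr h.symm)
        (fun p hp q hq hqy => ⟨y, StrictlyBetween.mem_Ioo
          (Or.inr ⟨lt_of_le_of_ne (not_lt.1 hq) hqy, hp⟩)⟩) hF
        ⟨a, h.2, h0.symm⟩ (t := t) (by
          rintro ⟨z, hz, hz'⟩
          rw [ht, OnePoint.coe_eq_coe] at hz'
          exact lt_asymm h.1 (hz' ▸ hz))
      exact ⟨s, hs, hs'.imp_right And.left⟩
  obtain ⟨s, hst, ⟨f, rfl, hf⟩ | hinf⟩ := main
  · refine (hitTime_le hrc hf).trans_lt (ENNReal.coe_lt_coe.2 (lt_of_le_of_ne hst ?_))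
    rintro rfl
    exact hayb.ne_right (OnePoint.coe_injective (hf.symm.trans ht))
  · exact absurd (ht.symm.trans (H.absorbed s t ω hst hinf)) (OnePoint.coe_ne_infty b)

/-- Before hitting the endpoints of an interval, a skip-free path stays in this interval. -/
theorem IsSkipFreePath.mem_Ioo {ω : Ω} (hE : IsNearlyClosed E) (hω : H.IsSkipFreePath ω)
    {a x b : E} (ha : AttainsHit (a : OnePoint E) (H.path ω))
    (hb : AttainsHit (b : OnePoint E) (H.path ω)) (hx : x ∈ Ioo a b)
    (h0 : H.X 0 ω = x) {t : ℝ≥0} (hta : t < hitTime (a : OnePoint E) (H.path ω))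
    (htb : t < hitTime (b : OnePoint E) (H.path ω)) :
    H.X t ω ∈ ((↑) : E → OnePoint E) '' Ioo a b := by
  have hrc := H.isRightContinuousPath ω
  by_contra hcon
  have hcl : closure (Ioo a b) ⊆ Icc a b :=
    closure_minimal Ioo_subset_Icc_self isClosed_Icc
  obtain ⟨s, hst, ⟨f, hf, hfs⟩ | ⟨hinf, hu⟩⟩ := hω.exists_exit (I := Ioo a b) (F := {a, b})
    isOpen_Ioo
    (fun z hz => by
      obtain ⟨h1, h2⟩ := hcl hz
      rcases h1.eq_or_lt with rfl | h1
      · exact Or.inr (Or.inl rfl)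
      rcases h2.eq_or_lt with rfl | h2
      · exact Or.inr (Or.inr rfl)
      exact Or.inl ⟨h1, h2⟩)
    (fun p hp q hq hqF => by
      have hqa : q ≠ a := fun h => hqF (Or.inl h)
      have hqb : q ≠ b := fun h => hqF (Or.inr h)
      rcases lt_or_gt_of_ne hqa with h | h
      · exact ⟨a, StrictlyBetween.mem_Ioo (Or.inr ⟨h, hp.1⟩)⟩
      · rcases lt_or_gt_of_ne hqb with h' | h'
        · exact absurd ⟨h, h'⟩ hq
        · exact ⟨b, StrictlyBetween.mem_Ioo (Or.inl ⟨hp.2, h'⟩)⟩)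
    (by rintro f (rfl | rfl) <;> assumption) ⟨x, hx, h0.symm⟩ hcon
  · have : hitTime (f : OnePoint E) (H.path ω) ≤ t :=
      (hitTime_le hrc hfs).trans (ENNReal.coe_le_coe.2 hst)
    rcases hf with rfl | rfl
    · exact hta.not_ge this
    · exact htb.not_ge this
  · have hs0 : 0 < s := by
      refine pos_iff_ne_zero.2 fun h => ?_
      rw [h, h0] at hinf
      exact OnePoint.coe_ne_infty x hinf
    have hlife := H.lifetime_eq hs0 hinf fun u hus => by
      obtain ⟨z, -, hz⟩ := hu u hus
      rw [← hz]; exact OnePoint.coe_ne_infty z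
    have hl := hω.leftLimit_lifetime s hlife
    -- Death inside (a,b) is impossible: the left limit would be the cemetery, but compactness of
    -- [a,b] keeps the path away from it.
    have hK : (((↑) : E → OnePoint E) '' Icc a b)ᶜ ∈ 𝓝 (OnePoint.infty : OnePoint E) :=
      (OnePoint.isOpen_compl_image_coe.2 ⟨isClosed_Icc, hE.isCompact_Icc a b⟩).mem_nhds (by simp)
    have : (𝓝[<] s).NeBot := nhdsLT_neBot_of_exists_lt ⟨0, hs0⟩
    obtain ⟨u, hu1, hu2⟩ := ((hl.eventually_mem hK).and self_mem_nhdsWithin).exists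
    exact hu1 (image_mono Ioo_subset_Icc_self (hu u hu2))

end HuntProcess

/-! ### Exit probabilities of intervals -/

namespace HuntProcess

variable {E : Set EReal} {Ω : Type*} [MeasurableSpace Ω] (H : HuntProcess E Ω)
  [T3Space (OnePoint E)] [SecondCountableTopology (OnePoint E)]

/-- The measurable version of the hitting time of a point of `E`. -/
def T (c : E) (ω : Ω) : ℝ≥0∞ := hitTime (c : OnePoint E) (H.path ω)

/-- The hitting time of `c` for the path after the hitting time of `y`. -/
def TAfter (y c : E) (ω : Ω) : ℝ≥0∞ :=
  hitTime (c : OnePoint E) (shiftPath (H.T y ω).toNNReal (H.path ω))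

theorem measurable_T (c : E) : Measurable (H.T c) :=
  (measurable_hitTime (c : OnePoint E)).comp H.measurable_path

variable {H} in
theorem T_le_add_TAfter {y c : E} {ω : Ω} (hy : H.T y ω < ∞) :
    H.T c ω ≤ H.T y ω + H.TAfter y c ω := by
  have := hitTime_le_add_shift (c : OnePoint E) (H.isRightContinuousPath ω) (H.T y ω).toNNReal
  rwa [ENNReal.coe_toNNReal hy.ne] at this

variable {H} in
theorem T_eq_add_TAfter {y c : E} {ω : Ω} (hc : AttainsHit (c : OnePoint E) (H.path ω))
    (hy : H.T y ω < ∞) (hyc : H.T y ω ≤ H.T c ω) :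
    H.T c ω = H.T y ω + H.TAfter y c ω := by
  have := hc.hitTime_eq_add_shift (H.isRightContinuousPath ω) (u := (H.T y ω).toNNReal)
  rw [ENNReal.coe_toNNReal hy.ne] at this
  exact this hyc

variable {H} in
theorem T_ne {a b : E} {ω : Ω} (ha : AttainsHit (a : OnePoint E) (H.path ω))
    (hb : AttainsHit (b : OnePoint E) (H.path ω)) (hab : a ≠ b) (h : H.T a ω < ∞) :
    H.T a ω ≠ H.T b ω := by
  intro heq
  obtain ⟨t, ht⟩ := WithTop.ne_top_iff_exists.1 h.ne
  exact hab (OnePoint.coe_injective ((ha t ht.symm).symm.trans (hb t (heq.symm.trans ht.symm))))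

theorem T_pos {a b : E} {ω : Ω} (h0 : H.X 0 ω = a)
    (hb : AttainsHit (b : OnePoint E) (H.path ω)) (hab : a ≠ b) : 0 < H.T b ω := by
  refine pos_iff_ne_zero.2 fun h => hab ?_
  exact OnePoint.coe_injective (h0.symm.trans (hb 0 h))

/-- The strong Markov property at the hitting time of `y`. -/
theorem prob_inter_TAfter (x : OnePoint E) (y : E) {A : Set Ω}
    (hA : MeasurableSet[(H.isStoppingTime_hitStop (y : OnePoint E)).measurableSpace] A)
    {C : Set (ℝ≥0 → OnePoint E)} (hC : MeasurableSet C) :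
    H.P x (A ∩ {ω | H.T y ω < ∞} ∩ {ω | shiftPath (H.T y ω).toNNReal (H.path ω) ∈ C}) =
      H.P x (A ∩ {ω | H.T y ω < ∞}) * H.P y {ω | H.path ω ∈ C} :=
  H.strongMarkov_hitStop x y hA hC

theorem ae_hit_eq_T {x c : E} (hxc : x ≠ c) :
    ∀ᵐ ω ∂(H.P x), H.hit c ω = H.T c ω := by
  filter_upwards [H.start (x : OnePoint E), H.ae_attainsHit x c] with ω h0 hc
  refine H.hit_eq_hitTime ?_ hc
  rw [h0]
  exact fun h => hxc (OnePoint.coe_injective h)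

variable {H} (hH : H.IsSkipFree)
include hH

namespace IsSkipFree

theorem prob_T_lt_top_pos {x c : E} (hxc : x ≠ c) : 0 < H.P x {ω | H.T c ω < ∞} := by
  refine (hH.regular x c).trans_eq (measure_congr ?_)
  filter_upwards [H.ae_hit_eq_T hxc] with ω hω
  exact congrArg (· < ∞) hω

/-- Points in between are visited first. -/
theorem ae_T_lt {a y b : E} (h : StrictlyBetween a y b) :
    ∀ᵐ ω ∂(H.P a), H.T b ω < ∞ → H.T y ω < H.T b ω := by
  filter_upwards [hH.ae_isSkipFreePath a, H.start (a : OnePoint E), H.ae_attainsHit a y,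
    H.ae_attainsHit a b] with ω hω h0 hy hb hlt
  obtain ⟨t, ht⟩ := WithTop.ne_top_iff_exists.1 hlt.ne
  exact (hω.hitTime_lt hy h h0 (hb t ht.symm)).trans_eq ht

/-- A path from a to b passes y, and the part of it after `T y` is shorter; the process restarts at
y. -/
theorem prob_T_le_le {a y b : E} (h : StrictlyBetween a y b) (t : ℝ≥0) :
    H.P a {ω | H.T b ω ≤ t} ≤ H.P y {ω | H.T b ω ≤ t} := by
  have hC : MeasurableSet {w : ℝ≥0 → OnePoint E | hitTime (b : OnePoint E) w ≤ t} :=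
    measurableSet_le (measurable_hitTime _) measurable_const
  have hSM := H.prob_inter_TAfter (a : OnePoint E) y (A := univ) MeasurableSet.univ hC
  calc H.P a {ω | H.T b ω ≤ t}
      ≤ H.P a (univ ∩ {ω | H.T y ω < ∞} ∩
          {ω | shiftPath (H.T y ω).toNNReal (H.path ω) ∈
            {w : ℝ≥0 → OnePoint E | hitTime (b : OnePoint E) w ≤ t}}) := by
        refine measure_mono_ae ?_
        filter_upwards [hH.ae_T_lt h, H.ae_attainsHit a b] with ω hω hb hbt
        have hlt := hω (lt_of_le_of_lt hbt ENNReal.coe_lt_top)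
        have hy : H.T y ω < ∞ := hlt.trans_le le_top
        refine ⟨⟨trivial, hy⟩, ?_⟩
        have := T_eq_add_TAfter hb hy hlt.le
        exact (le_add_self.trans_eq this.symm).trans hbt
    _ ≤ H.P y {ω | H.T b ω ≤ t} := by
        rw [hSM]
        exact mul_le_of_le_one_left zero_le prob_le_one

theorem exists_nat_prob_T_le_pos {a b : E} (hab : a ≠ b) :
    ∃ n : ℕ, 0 < H.P a {ω | H.T b ω ≤ (n : ℝ≥0)} := by
  by_contra! hcon
  refine (hH.prob_T_lt_top_pos hab).ne' ?_
  have : {ω | H.T b ω < ∞} = ⋃ n : ℕ, {ω | H.T b ω ≤ (n : ℝ≥0)} := by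
    ext ω
    simp only [mem_ofPred_eq, mem_iUnion, ENNReal.coe_natCast]
    constructor
    · intro h
      obtain ⟨n, hn⟩ := ENNReal.exists_nat_gt h.ne
      exact ⟨n, hn.le⟩
    · rintro ⟨n, hn⟩
      exact hn.trans_lt (ENNReal.natCast_lt_top n)
  rw [this]
  exact measure_iUnion_null fun n => le_zero_iff.1 (hcon n)

/-- Bounded intervals are left in finite time. -/
theorem ae_T_lt_top (hE : IsNearlyClosed E) {a x b : E} (hax : a < x) (hxb : x < b) :
    ∀ᵐ ω ∂(H.P x), H.T a ω < ∞ ∨ H.T b ω < ∞ := by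
  obtain ⟨n, hn⟩ := hH.exists_nat_prob_T_le_pos (hax.trans hxb).ne
  set ε := H.P a {ω | H.T b ω ≤ (n : ℝ≥0)} with hε
  -- Neither endpoint has been hit by time kn; each further period of length n costs a factor 1 - ε.
  let A : ℕ → Set Ω := fun k =>
    {ω | ((k * n : ℝ≥0) : ℝ≥0∞) < H.T a ω} ∩ {ω | ((k * n : ℝ≥0) : ℝ≥0∞) < H.T b ω}
  have hstep : ∀ k, H.P x (A (k + 1)) ≤ (1 - ε) * H.P x (A k) := by
    intro k
    set u : ℝ≥0 := k * n with hu
    have hst := isStoppingTime_const H.𝓕 u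
    have hAm : MeasurableSet[hst.measurableSpace] (A k) := by
      have h1 : MeasurableSet[H.𝓕 u] (A k) := by
        have h2 := (H.isStoppingTime_hitStop (a : OnePoint E) u).compl.inter
          (H.isStoppingTime_hitStop (b : OnePoint E) u).compl
        convert h2 using 1
        ext ω
        exact and_congr (not_le (a := H.T a ω)).symm (not_le (a := H.T b ω)).symm
      rwa [IsStoppingTime.measurableSpace_const]
    have hAm' : MeasurableSet (A k) := hst.measurableSpace_le _ hAm
    let C : Set (ℝ≥0 → OnePoint E) := {w | ((n : ℝ≥0) : ℝ≥0∞) < hitTime (b : OnePoint E) w}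
    have hC : MeasurableSet C := measurableSet_lt measurable_const (measurable_hitTime _)
    have hSM := H.strongMarkov_path hst x hAm hC
    have htop : A k ∩ {ω : Ω | (u : WithTop ℝ≥0) < ⊤} = A k := by
      ext ω
      exact and_iff_left (WithTop.coe_lt_top u)
    rw [htop] at hSM
    calc H.P x (A (k + 1))
        ≤ H.P x (A k ∩ {ω | H.pathFrom (fun _ => (u : WithTop ℝ≥0)) ω ∈ C}) := by
          refine measure_mono fun ω hω => ?_
          have hle : (u : ℝ≥0∞) ≤ (((k + 1 : ℕ) * n : ℝ≥0) : ℝ≥0∞) := by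
            rw [ENNReal.coe_le_coe, hu]; push_cast; gcongr; simp
          refine ⟨⟨hle.trans_lt hω.1, hle.trans_lt hω.2⟩, ?_⟩
          change H.pathFrom _ ω ∈ C
          rw [H.pathFrom_of_eq (t := u) rfl]
          have h1 := hitTime_le_add_shift (b : OnePoint E) (H.isRightContinuousPath ω) u
          have h2 : ((u + n : ℝ≥0) : ℝ≥0∞) < u + hitTime (b : OnePoint E)
              (shiftPath u (H.path ω)) := by
            refine lt_of_lt_of_le ?_ h1
            have : (((k + 1 : ℕ) * n : ℝ≥0) : ℝ≥0) = u + n := by rw [hu]; push_cast; ring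
            rw [← this]; exact hω.2
          rw [ENNReal.coe_add] at h2
          exact lt_of_add_lt_add_left h2
      _ = ∫⁻ ω in A k, H.P (H.stateAt (fun _ => (u : WithTop ℝ≥0)) ω) {ω' | H.path ω' ∈ C}
            ∂(H.P x) := hSM
      _ ≤ ∫⁻ ω in A k, (1 - ε) ∂(H.P x) := by
          refine setLIntegral_mono_ae measurable_const.aemeasurable ?_
          filter_upwards [hH.ae_isSkipFreePath x, H.start (x : OnePoint E), H.ae_attainsHit x a,
            H.ae_attainsHit x b] with ω hω h0 ha hb hωA
          obtain ⟨z, hz, hzX⟩ := hω.mem_Ioo hE ha hb ⟨hax, hxb⟩ h0 hωA.1 hωA.2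
          rw [H.stateAt_of_eq (t := u) rfl, ← hzX]
          -- The point a is the worst case: from any z in (a,b), b is hit by time n with probability
          -- at least ε.
          have h1 := hH.prob_T_le_le (a := a) (y := z) (b := b) (Or.inl hz) n
          have h2 : {ω' | H.path ω' ∈ C} = {ω | H.T b ω ≤ (n : ℝ≥0)}ᶜ := by
            ext ω'
            exact (not_le (a := H.T b ω')).symm
          rw [h2, prob_compl_eq_one_sub (measurableSet_le (H.measurable_T b) measurable_const)]
          exact tsub_le_tsub_left h1 1
      _ = (1 - ε) * H.P x (A k) := by rw [setLIntegral_const]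
  have hpow : ∀ k, H.P x (A k) ≤ (1 - ε) ^ k := by
    intro k
    induction k with
    | zero => simpa using prob_le_one
    | succ k ih => exact (hstep k).trans (by rw [pow_succ']; gcongr)
  have hlim : Tendsto (fun k => (1 - ε) ^ k) atTop (𝓝 0) :=
    ENNReal.tendsto_pow_atTop_nhds_zero_of_lt_one
      (ENNReal.sub_lt_self ENNReal.one_ne_top one_ne_zero hn.ne')
  have hzero : H.P x {ω | H.T a ω = ∞ ∧ H.T b ω = ∞} = 0 := by
    refine le_antisymm (ge_of_tendsto' hlim fun k => ?_) zero_le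
    refine (measure_mono fun ω hω => ?_).trans (hpow k)
    exact ⟨ENNReal.coe_lt_top.trans_eq (show H.T a ω = ∞ from hω.1).symm,
      ENNReal.coe_lt_top.trans_eq (show H.T b ω = ∞ from hω.2).symm⟩
  filter_upwards [measure_eq_zero_iff_ae_notMem.1 hzero] with ω hω
  by_contra! h
  exact hω ⟨top_le_iff.1 h.1, top_le_iff.1 h.2⟩

theorem ae_T_lt_top' (hE : IsNearlyClosed E) {a x b : E} (h : StrictlyBetween a x b) :
    ∀ᵐ ω ∂(H.P x), H.T a ω < ∞ ∨ H.T b ω < ∞ := by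
  rcases h with h | h
  · exact hH.ae_T_lt_top hE h.1 h.2
  · filter_upwards [hH.ae_T_lt_top hE h.1 h.2] with ω hω using hω.symm

/-- To hit b before a the path must first hit y, again before a; then it restarts at y. The position
of a is arbitrary, so both directions are covered. -/
theorem prob_T_lt_mul {x y b : E} (a : E) (h : StrictlyBetween x y b) :
    H.P x {ω | H.T b ω < H.T a ω} =
      H.P x {ω | H.T y ω < H.T a ω} * H.P y {ω | H.T b ω < H.T a ω} := by
  have hA : MeasurableSet[(H.isStoppingTime_hitStop (y : OnePoint E)).measurableSpace]
      {ω | H.T y ω < H.T a ω} := by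
    convert (IsStoppingTime.measurableSet_stopping_time_le
      (H.isStoppingTime_hitStop (a : OnePoint E))
      (H.isStoppingTime_hitStop (y : OnePoint E))).compl using 1
    ext ω
    exact (not_le (a := H.T a ω)).symm
  have hC : MeasurableSet {w : ℝ≥0 → OnePoint E |
      hitTime (b : OnePoint E) w < hitTime (a : OnePoint E) w} :=
    measurableSet_lt (measurable_hitTime _) (measurable_hitTime _)
  have hSM := H.prob_inter_TAfter (x : OnePoint E) y hA hC
  have htop : {ω | H.T y ω < H.T a ω} ∩ {ω | H.T y ω < ∞} = {ω | H.T y ω < H.T a ω} :=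
    inter_eq_left.2 fun ω hω => (show H.T y ω < H.T a ω from hω).trans_le le_top
  rw [htop] at hSM
  refine Eq.trans (measure_congr ?_) hSM
  filter_upwards [hH.ae_T_lt h, H.ae_attainsHit x a, H.ae_attainsHit x b] with ω hω ha hb
  refine propext ⟨fun hba => ?_, fun ⟨hya, hsh⟩ => ?_⟩
  · have hba : H.T b ω < H.T a ω := hba
    have hyb := hω (hba.trans_le le_top)
    have hya := hyb.trans hba
    have hy : H.T y ω < ∞ := hya.trans_le le_top
    refine ⟨hya, ?_⟩
    rw [T_eq_add_TAfter hb hy hyb.le, T_eq_add_TAfter ha hy hya.le] at hba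
    exact lt_of_add_lt_add_left hba
  · have hya : H.T y ω < H.T a ω := hya
    have hy : H.T y ω < ∞ := hya.trans_le le_top
    have hsh : H.TAfter y b ω < H.TAfter y a ω := hsh
    change H.T b ω < H.T a ω
    rw [T_eq_add_TAfter ha hy hya.le]
    exact (T_le_add_TAfter hy).trans_lt (ENNReal.add_lt_add_left hy.ne hsh)

/-- One of the two times is finite, and the path cannot be at a and at b simultaneously, so ties are
null. -/
theorem prob_T_lt_add (hE : IsNearlyClosed E) {a x b : E} (h : StrictlyBetween a x b) :
    H.P x {ω | H.T b ω < H.T a ω} + H.P x {ω | H.T a ω < H.T b ω} = 1 := by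
  have hm := measurableSet_lt (H.measurable_T b) (H.measurable_T a)
  rw [← prob_add_prob_compl (μ := H.P x) hm]
  congr 1
  refine measure_congr ?_
  filter_upwards [hH.ae_T_lt_top' hE h, H.ae_attainsHit x a, H.ae_attainsHit x b] with ω hω ha hb
  refine propext ⟨fun h => not_lt.2 (le_of_lt h), fun h' => ?_⟩
  have hle : H.T a ω ≤ H.T b ω := not_lt.1 h'
  refine lt_of_le_of_ne hle ?_
  rcases hω with hω | hω
  · exact T_ne ha hb h.ne hω
  · exact (T_ne hb ha h.ne.symm hω).symm

theorem prob_T_lt_pos {a x b : E} (h : StrictlyBetween a x b) :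
    0 < H.P x {ω | H.T b ω < H.T a ω} := by
  refine pos_iff_ne_zero.2 fun hzero => ?_
  have hle : ∀ᵐ ω ∂(H.P x), H.T a ω ≤ H.T b ω := by
    filter_upwards [measure_eq_zero_iff_ae_notMem.1 hzero] with ω hω using not_lt.1 hω
  -- Such δ exists because `T a` is a.s. positive under P_x.
  obtain ⟨δ, hδ0, hδ⟩ : ∃ δ : ℝ≥0, 0 < δ ∧ H.P x {ω | H.T a ω ≤ δ} < 1 := by
    by_contra! hcon
    have hall : ∀ᵐ ω ∂(H.P x), ∀ n : ℕ, H.T a ω ≤ ((1 / (n + 1 : ℝ≥0) : ℝ≥0) : ℝ≥0∞) := by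
      refine ae_all_iff.2 fun n => ?_
      have := hcon (1 / (n + 1 : ℝ≥0)) (by positivity)
      exact (mem_ae_iff_prob_eq_one
        (measurableSet_le (H.measurable_T a) measurable_const)).2 (le_antisymm prob_le_one this)
    obtain ⟨ω, h1, h2, h3⟩ := (hall.and ((H.start (x : OnePoint E)).and (H.ae_attainsHit x a))).exists
    have hlim : Tendsto (fun n : ℕ => ((1 / (n + 1 : ℝ≥0) : ℝ≥0) : ℝ≥0∞)) atTop (𝓝 0) := by
      rw [← ENNReal.coe_zero, ENNReal.tendsto_coe]
      exact tendsto_one_div_add_atTop_nhds_zero_nat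
    exact (ge_of_tendsto' hlim h1).not_gt (H.T_pos h2 h3 h.ne_left)
  have hg : ∀ k : ℕ, H.P a {ω | H.T b ω ≤ ((k * δ : ℝ≥0) : ℝ≥0∞)} = 0 := by
    intro k
    induction k with
    | zero =>
      rw [measure_eq_zero_iff_ae_notMem]
      filter_upwards [H.start (a : OnePoint E), H.ae_attainsHit a b] with ω h0 hb hω
      have : H.T b ω ≤ 0 := by simpa using hω
      exact this.not_gt (H.T_pos h0 hb h.ne)
    | succ k ih =>
      set t : ℝ≥0 := (k + 1 : ℕ) * δ with ht
      set s : ℝ≥0 := k * δ with hs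
      have hts : t = s + δ := by rw [ht, hs]; push_cast; ring
      have hC : ∀ r : ℝ≥0, MeasurableSet
          {w : ℝ≥0 → OnePoint E | hitTime (b : OnePoint E) w ≤ r} := fun r =>
        measurableSet_le (measurable_hitTime _) measurable_const
      have hA : MeasurableSet[(H.isStoppingTime_hitStop (a : OnePoint E)).measurableSpace]
          {ω | H.T a ω ≤ δ} := (H.isStoppingTime_hitStop (a : OnePoint E)).measurableSet_le' δ
      have h1 := H.prob_inter_TAfter (x : OnePoint E) a hA (hC t)
      have h2 := H.prob_inter_TAfter (x : OnePoint E) a (A := univ) MeasurableSet.univ (hC s)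
      set g := H.P a {ω | H.T b ω ≤ t} with hgdef
      -- With t = s + δ: b is reached only through x and then a again. A return by time δ leaves at
      -- most time t for b, hence the factor g; a slower return leaves at most time s, which has
      -- probability zero by induction. As the factor of g is below one, g vanishes.
      have h3 : g ≤ H.P x {ω | H.T a ω ≤ δ} * g := by
        calc g ≤ H.P x {ω | H.T b ω ≤ t} := hH.prob_T_le_le h t
          _ ≤ H.P x (({ω | H.T a ω ≤ δ} ∩ {ω | H.T a ω < ∞} ∩
                {ω | shiftPath (H.T a ω).toNNReal (H.path ω) ∈
                  {w : ℝ≥0 → OnePoint E | hitTime (b : OnePoint E) w ≤ t}}) ∪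
              (univ ∩ {ω | H.T a ω < ∞} ∩
                {ω | shiftPath (H.T a ω).toNNReal (H.path ω) ∈
                  {w : ℝ≥0 → OnePoint E | hitTime (b : OnePoint E) w ≤ s}})) := by
              refine measure_mono_ae ?_
              filter_upwards [hle, H.ae_attainsHit x b] with ω hω hb hbt
              have hbt : H.T b ω ≤ t := hbt
              have ha : H.T a ω < ∞ := (hω.trans hbt).trans_lt ENNReal.coe_lt_top
              have heq := T_eq_add_TAfter hb ha hω
              rw [heq] at hbt
              by_cases haδ : H.T a ω ≤ δ
              · exact Or.inl ⟨⟨haδ, ha⟩, le_add_self.trans hbt⟩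
              · refine Or.inr ⟨⟨trivial, ha⟩, ?_⟩
                change H.TAfter a b ω ≤ s
                have h4 : (δ : ℝ≥0∞) + H.TAfter a b ω ≤ δ + s := by
                  refine (add_le_add (not_le.1 haδ).le le_rfl).trans (hbt.trans_eq ?_)
                  rw [hts, ENNReal.coe_add, add_comm]
                exact (ENNReal.add_le_add_iff_left ENNReal.coe_ne_top).1 h4
          _ ≤ _ + _ := measure_union_le _ _
          _ = H.P x {ω | H.T a ω ≤ δ} * g := by
              rw [h1, h2]
              have h5 : H.P a {ω | H.path ω ∈
                  {w : ℝ≥0 → OnePoint E | hitTime (b : OnePoint E) w ≤ s}} = 0 := ih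
              have h6 : {ω | H.T a ω ≤ δ} ∩ {ω | H.T a ω < ∞} = {ω | H.T a ω ≤ δ} :=
                inter_eq_left.2 fun ω hω => lt_of_le_of_lt hω ENNReal.coe_lt_top
              rw [h5, h6, mul_zero, add_zero]
              rfl
      by_contra hne
      have h7 : H.P x {ω | H.T a ω ≤ δ} * g < 1 * g :=
        ENNReal.mul_lt_mul_left hne (measure_ne_top _ _) hδ
      rw [one_mul] at h7
      exact h3.not_gt h7
  refine (hH.prob_T_lt_top_pos h.ne).ne' ?_
  refine measure_mono_null (t := ⋃ k : ℕ, {ω | H.T b ω ≤ ((k * δ : ℝ≥0) : ℝ≥0∞)})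
    (fun ω hω => ?_) (measure_iUnion_null hg)
  obtain ⟨t, ht⟩ := WithTop.ne_top_iff_exists.1 (show H.T b ω < ∞ from hω).ne
  obtain ⟨k, hk⟩ := exists_nat_ge (t / δ)
  refine mem_iUnion.2 ⟨k, ?_⟩
  change H.T b ω ≤ _
  rw [← ht]
  exact ENNReal.coe_le_coe.2 ((div_le_iff₀ hδ0).1 hk)

/-- Continuity of the exit probabilities in the endpoint which is approached from inside. -/
theorem tendsto_prob_T_lt (hE : IsNearlyClosed E) {a c x : E} {u : ℕ → E}
    (hacx : StrictlyBetween a c x) (hu : ∀ n, StrictlyBetween c (u n) (u (n + 1)))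
    (hux : ∀ n, StrictlyBetween c (u n) x) (hlim : Tendsto u atTop (𝓝 x)) :
    Tendsto (fun n => H.P c {ω | H.T (u n) ω < H.T a ω}) atTop
      (𝓝 (H.P c {ω | H.T x ω < H.T a ω})) := by
  refine tendsto_measure_of_ae_tendsto_indicator_of_isFiniteMeasure atTop
    (measurableSet_lt (H.measurable_T x) (H.measurable_T a))
    (fun n => measurableSet_lt (H.measurable_T (u n)) (H.measurable_T a)) ?_
  filter_upwards [hH.ae_T_lt_top' hE hacx, ae_all_iff.2 fun n => hH.ae_T_lt (hu n),
    ae_all_iff.2 fun n => hH.ae_T_lt (hux n), H.ae_attainsHit c a, H.ae_attainsHit c x,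
    ae_all_iff.2 fun n => H.ae_attainsHit c (u n)] with ω hfin hmono hlt ha hx hun
  by_cases hω : H.T x ω < H.T a ω
  · refine Eventually.of_forall fun n => iff_of_true ?_ hω
    exact (hlt n (hω.trans_le le_top)).trans hω
  · have hω' := not_lt.1 hω
    have haf : H.T a ω < ∞ := by
      rcases hfin with h | h
      · exact h
      · exact hω'.trans_lt h
    by_contra hcon
    have hmon : Monotone fun n => H.T (u n) ω := by
      refine monotone_nat_of_le_succ fun n => ?_
      by_cases h : H.T (u (n + 1)) ω < ∞
      · exact (hmono n h).le
      · exact le_top.trans (not_lt.1 h)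
    -- Since the times increase, one failure would persist and give the desired convergence; so
    -- assume there is none.
    have hall : ∀ n, H.T (u n) ω < H.T a ω := by
      intro n
      by_contra hn
      refine hcon (eventually_atTop.2 ⟨n, fun m hm => iff_of_false (fun h => hn ?_) hω⟩)
      exact (hmon hm).trans_lt h
    obtain ⟨α, hα⟩ := WithTop.ne_top_iff_exists.1 haf.ne
    have hex : ∀ n, ∃ t : ℝ≥0, (t : ℝ≥0∞) = H.T (u n) ω := fun n =>
      WithTop.ne_top_iff_exists.1 ((hall n).trans haf).ne
    choose t ht using hex
    have htmono : StrictMono t := strictMono_nat_of_lt_succ fun n => by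
      have := hmono n ((hall (n + 1)).trans haf)
      rwa [← ht, ← ht, ENNReal.coe_lt_coe] at this
    have hbdd : BddAbove (range t) := by
      refine ⟨α, ?_⟩
      rintro _ ⟨n, rfl⟩
      have := (hall n).le
      rw [← ht, ← hα] at this
      exact WithTop.coe_le_coe.1 this
    set s := ⨆ n, t n with hs
    have hts : Tendsto t atTop (𝓝 s) := tendsto_atTop_ciSup htmono.monotone hbdd
    have hlts : ∀ n, t n < s := fun n => (htmono n.lt_succ_self).trans_le (le_ciSup hbdd _)
    have hsα : s ≤ α := ciSup_le fun n => by
      have := (hall n).le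
      rw [← ht, ← hα] at this
      exact WithTop.coe_le_coe.1 this
    have hs0 : 0 < s := zero_le.trans_lt (hlts 0)
    obtain ⟨y, hy⟩ := H.exists_leftLimit ω s hs0
    have h1 : Tendsto (fun n => H.X (t n) ω) atTop (𝓝 y) :=
      hy.comp (tendsto_nhdsWithin_iff.2 ⟨hts, Eventually.of_forall hlts⟩)
    have h2 : (fun n => H.X (t n) ω) = fun n => ((u n : E) : OnePoint E) :=
      funext fun n => hun n (t n) (ht n).symm
    rw [h2] at h1
    have hyx : y = x :=
      tendsto_nhds_unique h1 ((OnePoint.continuous_coe.tendsto x).comp hlim)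
    subst hyx
    have h3 : H.T x ω ≤ s := hitTime_le_of_leftLimit (H.isRightContinuousPath ω) hs0 hy
    have h4 : (s : ℝ≥0∞) ≤ H.T a ω := (ENNReal.coe_le_coe.2 hsα).trans_eq hα
    -- The limit x is hit by time s, hence no later than a, but by assumption no earlier: a tie,
    -- which is impossible.
    exact T_ne ha hx hacx.ne haf (le_antisymm hω' (h3.trans h4))

end IsSkipFree
end HuntProcess

/-! ### Real analysis: construction, continuity and uniqueness of scale functions -/

/-- A family of exit probabilities `r a x b`, `a < x < b`, which is multiplicative in both
directions is given by a scale function. -/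
theorem exists_strictMono_of_exitProb {α : Type*} [LinearOrder α] (r : α → α → α → ℝ)
    (hpos : ∀ a x b, a < x → x < b → 0 < r a x b)
    (hlt : ∀ a x b, a < x → x < b → r a x b < 1)
    (hmul : ∀ a x y b, a < x → x < y → y < b → r a x b = r a x y * r a y b)
    (hmul' : ∀ a x y b, a < x → x < y → y < b →
      1 - r a y b = (1 - r x y b) * (1 - r a x b)) :
    ∃ s : α → ℝ, StrictMono s ∧
      ∀ a x b, a < x → x < b → r a x b = (s x - s a) / (s b - s a) := by
  rcases subsingleton_or_nontrivial α with hα | hα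
  · exact ⟨0, Subsingleton.strictMono _, fun a x b h => absurd (Subsingleton.elim a x) h.ne⟩
  obtain ⟨a₀, b₀, h₀⟩ := exists_pair_lt α
  -- The exit probability as a function on [a,b], with boundary values 0 and 1: a scale function for
  -- this interval.
  let u : α → α → α → ℝ := fun a b x => if x ≤ a then 0 else if b ≤ x then 1 else r a x b
  have u_left : ∀ a b, u a b a = 0 := fun a b => by simp [u]
  have u_right : ∀ a b, a < b → u a b b = 1 := fun a b h => by simp [u, h.not_ge]
  have u_mid : ∀ a x b, a < x → x < b → u a b x = r a x b := fun a x b h h' => by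
    simp [u, h.not_ge, h'.not_ge]
  have u_mono : ∀ a b x y, a ≤ x → x < y → y ≤ b → u a b x < u a b y := by
    intro a b x y hax hxy hyb
    rcases hax.eq_or_lt with rfl | hax
    · rcases hyb.eq_or_lt with rfl | hyb
      · rw [u_left, u_right _ _ hxy]; exact one_pos
      · rw [u_left, u_mid _ _ _ hxy hyb]; exact hpos _ _ _ hxy hyb
    · rw [u_mid _ _ _ hax (hxy.trans_le hyb)]
      rcases hyb.eq_or_lt with rfl | hyb
      · rw [u_right _ _ (hax.trans hxy)]; exact hlt _ _ _ hax hxy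
      · rw [u_mid _ _ _ (hax.trans hxy) hyb, hmul a x y b hax hxy hyb]
        exact mul_lt_of_lt_one_left (hpos _ _ _ (hax.trans hxy) hyb) (hlt _ _ _ hax hxy)
  -- On subintervals with left end a this is `hmul`; `hmul'` then moves the left end to c.
  have hu : ∀ a b c x d, a ≤ c → c < x → x < d → d ≤ b →
      r c x d = (u a b x - u a b c) / (u a b d - u a b c) := by
    have hleft : ∀ a b x d, a < x → x < d → d ≤ b → r a x d = u a b x / u a b d := by
      intro a b x d hax hxd hdb
      rw [u_mid a x b hax (hxd.trans_le hdb)]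
      rcases hdb.eq_or_lt with rfl | hdb
      · rw [u_right _ _ (hax.trans hxd), div_one]
      · rw [u_mid a d b (hax.trans hxd) hdb, hmul a x d b hax hxd hdb]
        rw [mul_div_assoc, div_self (hpos _ _ _ (hax.trans hxd) hdb).ne', mul_one]
    intro a b c x d hac hcx hxd hdb
    rcases hac.eq_or_lt with rfl | hac
    · rw [u_left, sub_zero, sub_zero]; exact hleft _ _ _ _ hcx hxd hdb
    · have h1 := hmul' a c x d hac hcx hxd
      rw [hleft a b x d (hac.trans hcx) hxd hdb, hleft a b c d hac (hcx.trans hxd) hdb] at h1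
      have hd : 0 < u a b d := by
        rw [← u_left a b]; exact u_mono _ _ _ _ le_rfl (hac.trans (hcx.trans hxd)) hdb
      have hcd : 0 < u a b d - u a b c := sub_pos.2 (u_mono _ _ _ _ hac.le (hcx.trans hxd) hdb)
      have hd' := hd.ne'
      have hcd' := hcd.ne'
      field_simp at h1 ⊢
      linarith
  -- Scale functions of nested intervals differ by an affine map. Normalising to 0 at a₀ and 1 at b₀
  -- removes this freedom, so the choices glue together.
  let N : α → α → α → ℝ := fun a b x => (u a b x - u a b a₀) / (u a b b₀ - u a b a₀)
  have u_sub : ∀ a b a' b' x, a ≤ a' → b' ≤ b → a' < b' → a' ≤ x → x ≤ b' →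
      u a' b' x = (u a b x - u a b a') / (u a b b' - u a b a') := by
    intro a b a' b' x ha hb hab hax hxb
    rcases hax.eq_or_lt with rfl | hax
    · rw [u_left, sub_self, zero_div]
    rcases hxb.eq_or_lt with rfl | hxb
    · rw [u_right _ _ hab, div_self (sub_pos.2 (u_mono _ _ _ _ ha hab hb)).ne']
    · rw [u_mid _ _ _ hax hxb]
      exact hu _ _ _ _ _ ha hax hxb hb
  have N_sub : ∀ a b a' b' x, a ≤ a' → b' ≤ b → a' ≤ a₀ → b₀ ≤ b' → a' ≤ x → x ≤ b' →
      N a' b' x = N a b x := by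
    intro a b a' b' x ha hb ha₀ hb₀ hax hxb
    have hab : a' < b' := ha₀.trans_lt (h₀.trans_le hb₀)
    have h1 : 0 < u a b b' - u a b a' := sub_pos.2 (u_mono _ _ _ _ ha hab hb)
    have h2 : 0 < u a b b₀ - u a b a₀ :=
      sub_pos.2 (u_mono _ _ _ _ (ha.trans ha₀) h₀ (hb₀.trans hb))
    simp only [N]
    rw [u_sub a b a' b' x ha hb hab hax hxb,
      u_sub a b a' b' a₀ ha hb hab ha₀ (h₀.le.trans hb₀),
      u_sub a b a' b' b₀ ha hb hab (ha₀.trans h₀.le) hb₀, ← sub_div, ← sub_div,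
      div_div_div_cancel_right₀ h1.ne']
    ring_nf
  let s : α → ℝ := fun x => N (min a₀ x) (max b₀ x) x
  have s_eq : ∀ a b x, a ≤ a₀ → b₀ ≤ b → a ≤ x → x ≤ b → s x = N a b x := fun a b x h1 h2 h3 h4 =>
    N_sub a b _ _ x (le_min h1 h3) (max_le h2 h4) (min_le_left _ _) (le_max_left _ _)
      (min_le_right _ _) (le_max_right _ _)
  have s_sub : ∀ a b x y, a ≤ a₀ → b₀ ≤ b → a ≤ x → x ≤ b → a ≤ y → y ≤ b →
      s y - s x = (u a b y - u a b x) / (u a b b₀ - u a b a₀) := by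
    intro a b x y h1 h2 h3 h4 h5 h6
    rw [s_eq a b x h1 h2 h3 h4, s_eq a b y h1 h2 h5 h6]
    simp only [N]
    rw [← sub_div]
    ring_nf
  refine ⟨s, fun x y hxy => ?_, fun a x b hax hxb => ?_⟩
  · have ha : min a₀ x ≤ x := min_le_right _ _
    have hb : y ≤ max b₀ y := le_max_right _ _
    rw [← sub_pos, s_sub (min a₀ x) (max b₀ y) x y (min_le_left _ _) (le_max_left _ _)
      ha (hxy.le.trans hb) (ha.trans hxy.le) hb]
    exact div_pos (sub_pos.2 (u_mono _ _ _ _ ha hxy hb))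
      (sub_pos.2 (u_mono _ _ _ _ (min_le_left _ _) h₀ (le_max_left _ _)))
  · have ha : min a₀ a ≤ a := min_le_right _ _
    have hb : b ≤ max b₀ b := le_max_right _ _
    have h1 := s_sub (min a₀ a) (max b₀ b) a x (min_le_left _ _) (le_max_left _ _)
      ha ((hax.trans hxb).le.trans hb) (ha.trans hax.le) (hxb.le.trans hb)
    have h2 := s_sub (min a₀ a) (max b₀ b) a b (min_le_left _ _) (le_max_left _ _)
      ha ((hax.trans hxb).le.trans hb) (ha.trans (hax.trans hxb).le) hb
    have h3 : 0 < u (min a₀ a) (max b₀ b) b₀ - u (min a₀ a) (max b₀ b) a₀ :=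
      sub_pos.2 (u_mono _ _ _ _ (min_le_left _ _) h₀ (le_max_left _ _))
    rw [h1, h2, div_div_div_cancel_right₀ h3.ne']
    exact hu _ _ _ _ _ ha hax hxb hb

/-- A strictly increasing function on a set of extended reals is continuous if it is so along
strictly monotone sequences. -/
theorem continuous_of_strictMono_of_tendsto {E : Set EReal} {s : E → ℝ} (hs : StrictMono s)
    (hleft : ∀ (u : ℕ → E) (x : E), StrictMono u → (∀ n, u n < x) → Tendsto u atTop (𝓝 x) →
      Tendsto (fun n => s (u n)) atTop (𝓝 (s x)))
    (hright : ∀ (u : ℕ → E) (x : E), StrictAnti u → (∀ n, x < u n) → Tendsto u atTop (𝓝 x) →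
      Tendsto (fun n => s (u n)) atTop (𝓝 (s x))) : Continuous s := by
  refine continuous_iff_continuousAt.2 fun x => ?_
  refine tendsto_order.2 ⟨fun t ht => ?_, fun t ht => ?_⟩
  -- If x is not a limit from below, a neighbourhood of x has no points below x and monotonicity
  -- suffices. Otherwise a sequence is chosen in `EReal`, because the subspace topology of E need
  -- not be its order topology.
  · by_cases hx : x ∈ closure (Iio x)
    · have hlub : IsLUB (((↑) : E → EReal) '' Iio x) x := by
        refine ⟨?_, fun b hb => ?_⟩
        · rintro _ ⟨y, hy, rfl⟩
          exact le_of_lt hy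
        · by_contra! hbx
          obtain ⟨y, hby, hyx⟩ := mem_closure_iff.1 hx _
            (isOpen_Ioi.preimage continuous_subtype_val) (show x ∈ Subtype.val ⁻¹' Ioi b from hbx)
          exact (hb (mem_image_of_mem _ hyx)).not_gt hby
      have hnot : (x : EReal) ∉ ((↑) : E → EReal) '' Iio x := by
        rintro ⟨y, hy, hyx⟩
        exact absurd (Subtype.ext hyx) (ne_of_lt hy)
      obtain ⟨v, hv, hvx, hvlim, hvm⟩ := hlub.exists_seq_strictMono_tendsto_of_notMem hnot
        ((closure_nonempty_iff.1 ⟨x, hx⟩).image _)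
      choose u hu huv using hvm
      have h := hleft u x (fun m n hmn => by
          have := hv hmn; rw [← huv, ← huv] at this; exact this) hu (by
          rw [tendsto_subtype_rng]; simpa only [huv] using hvlim)
      obtain ⟨n, hn⟩ := (h.eventually_const_lt ht).exists
      filter_upwards [isOpen_Ioi.mem_nhds (hu n)] with y hy
      exact hn.trans (hs hy)
    · filter_upwards [isClosed_closure.isOpen_compl.mem_nhds hx] with y hy
      exact ht.trans_le (hs.monotone (not_lt.1 fun hyx => hy (subset_closure hyx)))
  · by_cases hx : x ∈ closure (Ioi x)
    · have hglb : IsGLB (((↑) : E → EReal) '' Ioi x) x := by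
        refine ⟨?_, fun b hb => ?_⟩
        · rintro _ ⟨y, hy, rfl⟩
          exact le_of_lt hy
        · by_contra! hbx
          obtain ⟨y, hby, hyx⟩ := mem_closure_iff.1 hx _
            (isOpen_Iio.preimage continuous_subtype_val) (show x ∈ Subtype.val ⁻¹' Iio b from hbx)
          exact (hb (mem_image_of_mem _ hyx)).not_gt hby
      have hnot : (x : EReal) ∉ ((↑) : E → EReal) '' Ioi x := by
        rintro ⟨y, hy, hyx⟩
        exact absurd (Subtype.ext hyx) (ne_of_gt hy)
      obtain ⟨v, hv, hvx, hvlim, hvm⟩ := hglb.exists_seq_strictAnti_tendsto_of_notMem hnot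
        ((closure_nonempty_iff.1 ⟨x, hx⟩).image _)
      choose u hu huv using hvm
      have h := hright u x (fun m n hmn => by
          have := hv hmn; rw [← huv, ← huv] at this; exact this) hu (by
          rw [tendsto_subtype_rng]; simpa only [huv] using hvlim)
      obtain ⟨n, hn⟩ := (h.eventually_lt_const ht).exists
      filter_upwards [isOpen_Iio.mem_nhds (hu n)] with y hy
      exact (hs hy).trans hn
    · filter_upwards [isClosed_closure.isOpen_compl.mem_nhds hx] with y hy
      exact (hs.monotone (not_lt.1 fun hyx => hy (subset_closure hyx))).trans_lt ht

/-- A function is determined up to affine transformations by its cross ratios. -/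
theorem exists_affine_of_ratio_eq {α : Type*} [LinearOrder α] {s s' : α → ℝ}
    (hs : StrictMono s) (hs' : StrictMono s')
    (h : ∀ a x b, a < x → x < b → (s x - s a) / (s b - s a) = (s' x - s' a) / (s' b - s' a)) :
    ∃ k c : ℝ, 0 < k ∧ ∀ x, s' x = k * s x + c := by
  rcases subsingleton_or_nontrivial α with hα | hα
  · rcases isEmpty_or_nonempty α with hα' | ⟨⟨a⟩⟩
    · exact ⟨1, 0, one_pos, fun x => isEmptyElim x⟩
    · refine ⟨1, s' a - s a, one_pos, fun x => ?_⟩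
      rw [Subsingleton.elim x a]; ring
  obtain ⟨a, b, hab⟩ := exists_pair_lt α
  have h1 : 0 < s b - s a := sub_pos.2 (hs hab)
  have h2 : 0 < s' b - s' a := sub_pos.2 (hs' hab)
  -- Each position of x relative to a and b uses the ratio of the correspondingly ordered triple.
  have key : ∀ x, (s' x - s' a) * (s b - s a) = (s' b - s' a) * (s x - s a) := by
    intro x
    rcases lt_trichotomy x a with hxa | rfl | hxa
    · have h3 := h x a b hxa hab
      rw [div_eq_div_iff (sub_pos.2 (hs (hxa.trans hab))).ne'
        (sub_pos.2 (hs' (hxa.trans hab))).ne'] at h3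
      linear_combination h3
    · ring
    · rcases lt_trichotomy x b with hxb | rfl | hxb
      · have h3 := h a x b hxa hxb
        rw [div_eq_div_iff h1.ne' h2.ne'] at h3
        linear_combination -h3
      · ring
      · have h3 := h a b x hab hxb
        rw [div_eq_div_iff (sub_pos.2 (hs hxa)).ne' (sub_pos.2 (hs' hxa)).ne'] at h3
        linear_combination h3
  refine ⟨(s' b - s' a) / (s b - s a), s' a - (s' b - s' a) / (s b - s a) * s a,
    div_pos h2 h1, fun x => ?_⟩
  have h1' := h1.ne'
  field_simp
  linear_combination key x

/-! ### The scale function of a skip-free process -/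

namespace HuntProcess

theorem IsScaleFunction.exists_affine {E : Set EReal} {Ω : Type*} [MeasurableSpace Ω]
    {H : HuntProcess E Ω} {s s' : E → ℝ} (hs : H.IsScaleFunction s) (hs' : H.IsScaleFunction s') :
    ∃ α β : ℝ, 0 < α ∧ ∀ x : E, s' x = α * s x + β :=
  exists_affine_of_ratio_eq hs.strictMono hs'.strictMono fun a x b hax hxb =>
    (hs.prob_hit_lt a x b hax hxb).symm.trans (hs'.prob_hit_lt a x b hax hxb)

namespace IsSkipFree

variable {E : Set EReal} {Ω : Type*} [MeasurableSpace Ω] {H : HuntProcess E Ω}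
  [T3Space (OnePoint E)] [SecondCountableTopology (OnePoint E)]

theorem real_prob_T_lt_add (hH : H.IsSkipFree) (hE : IsNearlyClosed E) {a x b : E}
    (h : StrictlyBetween a x b) :
    (H.P x).real {ω | H.T b ω < H.T a ω} + (H.P x).real {ω | H.T a ω < H.T b ω} = 1 := by
  rw [measureReal_def, measureReal_def, ← ENNReal.toReal_add (measure_ne_top _ _)
    (measure_ne_top _ _), hH.prob_T_lt_add hE h, ENNReal.toReal_one]

theorem real_prob_T_lt_mul (hH : H.IsSkipFree) {x y b : E} (a : E) (h : StrictlyBetween x y b) :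
    (H.P x).real {ω | H.T b ω < H.T a ω} =
      (H.P x).real {ω | H.T y ω < H.T a ω} * (H.P y).real {ω | H.T b ω < H.T a ω} := by
  rw [measureReal_def, hH.prob_T_lt_mul a h, ENNReal.toReal_mul]
  rfl

theorem real_prob_T_lt_pos (hH : H.IsSkipFree) {a x b : E} (h : StrictlyBetween a x b) :
    0 < (H.P x).real {ω | H.T b ω < H.T a ω} :=
  ENNReal.toReal_pos (hH.prob_T_lt_pos h).ne' (measure_ne_top _ _)

theorem tendsto_real_prob_T_lt (hH : H.IsSkipFree) (hE : IsNearlyClosed E) {a c x : E} {u : ℕ → E}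
    (hacx : StrictlyBetween a c x) (hu : ∀ n, StrictlyBetween c (u n) (u (n + 1)))
    (hux : ∀ n, StrictlyBetween c (u n) x) (hlim : Tendsto u atTop (𝓝 x)) :
    Tendsto (fun n => (H.P c).real {ω | H.T (u n) ω < H.T a ω}) atTop
      (𝓝 ((H.P c).real {ω | H.T x ω < H.T a ω})) :=
  (ENNReal.tendsto_toReal (measure_ne_top _ _)).comp
    (hH.tendsto_prob_T_lt hE hacx hu hux hlim)

theorem exists_strictMono_prob_T_lt (hH : H.IsSkipFree) (hE : IsNearlyClosed E) :
    ∃ s : E → ℝ, StrictMono s ∧ ∀ a x b : E, a < x → x < b →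
      (H.P x).real {ω | H.T b ω < H.T a ω} = (s x - s a) / (s b - s a) := by
  have hcompl : ∀ a x b : E, a < x → x < b → 1 - (H.P x).real {ω | H.T b ω < H.T a ω} =
      (H.P x).real {ω | H.T a ω < H.T b ω} := fun a x b h h' => by
    rw [← hH.real_prob_T_lt_add hE (Or.inl ⟨h, h'⟩), add_sub_cancel_left]
  refine exists_strictMono_of_exitProb (fun a x b : E => (H.P x).real {ω | H.T b ω < H.T a ω})
    (fun a x b h h' => hH.real_prob_T_lt_pos (Or.inl ⟨h, h'⟩)) (fun a x b h h' => ?_)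
    (fun a x y b h1 h2 h3 => hH.real_prob_T_lt_mul a (Or.inl ⟨h2, h3⟩))
    (fun a x y b h1 h2 h3 => ?_)
  · have := hH.real_prob_T_lt_pos (a := b) (x := x) (b := a) (Or.inr ⟨h, h'⟩)
    rw [← hcompl a x b h h'] at this
    linarith
  · rw [hcompl a y b (h1.trans h2) h3, hcompl x y b h2 h3, hcompl a x b h1 (h2.trans h3)]
    exact hH.real_prob_T_lt_mul b (Or.inr ⟨h1, h2⟩)

/-- Exit probabilities started at a fixed point converge as one endpoint runs along the sequence;
the value of s there is the only varying term and can be solved for. -/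
theorem continuous_of_prob_T_lt (hH : H.IsSkipFree) (hE : IsNearlyClosed E) {s : E → ℝ}
    (hs : StrictMono s) (h : ∀ a x b : E, a < x → x < b →
      (H.P x).real {ω | H.T b ω < H.T a ω} = (s x - s a) / (s b - s a)) : Continuous s := by
  refine continuous_of_strictMono_of_tendsto hs (fun u x hu hux hlim => ?_)
    (fun u x hu hux hlim => ?_)
  · have h01 : u 0 < u 1 := hu one_pos
    have h12 : ∀ n, u 1 < u (n + 2) := fun n => hu (by omega)
    -- The first two terms serve as fixed endpoint and starting point, hence the index shift by 2.
    have h1 := hH.tendsto_real_prob_T_lt hE (a := u 0) (c := u 1) (x := x)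
      (u := fun n => u (n + 2)) (Or.inl ⟨h01, hux 1⟩) (fun n => Or.inl ⟨h12 n, hu (by omega)⟩)
      (fun n => Or.inl ⟨h12 n, hux _⟩) (hlim.comp (tendsto_add_atTop_nat 2))
    have hpos : 0 < s (u 1) - s (u 0) := sub_pos.2 (hs h01)
    have hposx : 0 < s x - s (u 0) := sub_pos.2 (hs (hux 0))
    rw [h (u 0) (u 1) x h01 (hux 1)] at h1
    have h2 := ((h1.inv₀ (div_pos hpos hposx).ne').const_mul (s (u 1) - s (u 0))).add_const
      (s (u 0))
    refine (tendsto_add_atTop_iff_nat 2).1 (Tendsto.congr (fun n => ?_) (h2.trans (le_of_eq ?_)))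
    · rw [h (u 0) (u 1) (u (n + 2)) h01 (h12 n)]
      field_simp
      ring
    · congr 1
      field_simp
      ring
  · have h01 : u 1 < u 0 := hu one_pos
    have h12 : ∀ n, u (n + 2) < u 1 := fun n => hu (by omega)
    have h1 := hH.tendsto_real_prob_T_lt hE (a := u 0) (c := u 1) (x := x)
      (u := fun n => u (n + 2)) (Or.inr ⟨hux 1, h01⟩) (fun n => Or.inr ⟨hu (by omega), h12 n⟩)
      (fun n => Or.inr ⟨hux _, h12 n⟩) (hlim.comp (tendsto_add_atTop_nat 2))
    have hpos : 0 < s (u 0) - s (u 1) := sub_pos.2 (hs h01)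
    -- For the lower exit the ratio formula is read through the complementary probability.
    have hval : ∀ y, y < u 1 → (H.P (u 1)).real {ω | H.T y ω < H.T (u 0) ω} =
        (s (u 0) - s (u 1)) / (s (u 0) - s y) := by
      intro y hy
      have h3 := hH.real_prob_T_lt_add hE (a := y) (x := u 1) (b := u 0) (Or.inl ⟨hy, h01⟩)
      rw [h y (u 1) (u 0) hy h01] at h3
      have h4 : s (u 0) - s y ≠ 0 := (sub_pos.2 (hs (hy.trans h01))).ne'
      rw [eq_sub_of_add_eq' h3, eq_div_iff h4, sub_mul, div_mul_cancel₀ _ h4]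
      ring
    have hposx : 0 < s (u 0) - s x := sub_pos.2 (hs (hux 0))
    rw [hval x (hux 1)] at h1
    have h2 := ((h1.inv₀ (div_pos hpos hposx).ne').const_mul (s (u 0) - s (u 1))).const_sub
      (s (u 0))
    refine (tendsto_add_atTop_iff_nat 2).1 (Tendsto.congr (fun n => ?_) (h2.trans (le_of_eq ?_)))
    · rw [hval (u (n + 2)) (h12 n)]
      field_simp
      ring
    · congr 1
      field_simp
      ring

end IsSkipFree

theorem hit_lt_ae_eq {E : Set EReal} {Ω : Type*} [MeasurableSpace Ω] (H : HuntProcess E Ω)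
    [T3Space (OnePoint E)] [SecondCountableTopology (OnePoint E)] {a x b : E}
    (hax : a < x) (hxb : x < b) :
    {ω | H.hit b ω < H.hit a ω} =ᵐ[H.P x] {ω | H.T b ω < H.T a ω} := by
  filter_upwards [H.ae_hit_eq_T hax.ne', H.ae_hit_eq_T hxb.ne] with ω h1 h2
  refine propext ?_
  change H.hit b ω < H.hit a ω ↔ H.T b ω < H.T a ω
  rw [h1, h2]

end HuntProcess

end

theorem mainTheorem1 {E : Set EReal} (hE : IsNearlyClosed E) {Ω : Type*} [MeasurableSpace Ω]
    (H : HuntProcess E Ω) (hH : H.IsSkipFree) :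
    (∀ a x b : E, a < x → x < b →
      NullMeasurableSet {ω | H.hit b ω < H.hit a ω} (H.P x)) ∧
    (∃ s : E → ℝ, H.IsScaleFunction s) ∧
    (∀ s s' : E → ℝ, H.IsScaleFunction s → H.IsScaleFunction s' →
      ∃ α β : ℝ, 0 < α ∧ ∀ x : E, s' x = α * s x + β) := by
  have := hE.locallyCompactSpace
  have := OnePoint.secondCountableTopology_of_locallyCompact E
  refine ⟨fun a x b hax hxb => ?_, ?_, fun s s' hs hs' => hs.exists_affine hs'⟩
  · exact (measurableSet_lt (H.measurable_T b) (H.measurable_T a)).nullMeasurableSet.congr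
      (H.hit_lt_ae_eq hax hxb).symm
  · obtain ⟨s, hs, h⟩ := hH.exists_strictMono_prob_T_lt hE
    exact ⟨s, hH.continuous_of_prob_T_lt hE hs h, hs, fun a x b hax hxb =>
      (measureReal_congr (H.hit_lt_ae_eq hax hxb)).trans (h a x b hax hxb)⟩
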